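/- For $k\ge 1$ write $[k]=\{1,\dots,k\}$ and let $\mathcal L(k)$ be the set of labelled graphs on $[k]$, i.e. pairs $(H,\pi)$ of a graph $H$ with vertex set $[k]$ and a bijection $\pi:[k]\to V(H)$. Let $\Phi=(\phi_1,\phi_2,\dots)$ be any family of functions $\phi_k:\mathcal L(k)\to\{0,1\}$, and put $\mathcal H_{\phi_k}=\{(H,\pi)\in\mathcal L(k):\phi_k(H,\pi)=1\}$. For a finite graph $G=(V,E)$ let $\mathrm{StrEmb}(\mathcal H_{\phi_k},G)$ be the number of injective maps $\theta:[k]\to V$ for which there is some $(H,\pi)\in\mathcal H_{\phi_k}$ such that, for all $i,j\in[k]$, $\theta(i)\theta(j)\in E(G)\iff\pi(i)\pi(j)\in E(H)$. For a colouring $f:V\to[k]$ (an arbitrary map) let $\mathrm{ColStrEmb}(\mathcal H_{\phi_k},G,f)$ be the number of those maps $\theta$ for which, in addition, $\theta([k])$ is colourful, i.e. contains exactly one vertex of each colour $i\in[k]$. The problem p-#Induced Subgraph With Property($\Phi$) has as input a finite graph $G$ and an integer $k\ge1$, has parameter $k$, and asks for $\mathrm{StrEmb}(\mathcal H_{\phi_k},G)$.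 The problem p-#Multicolour Induced Subgraph with Property($\Phi$) has as input a finite graph $G$, an integer $k\ge1$ and a colouring $f:V(G)\to[k]$, has parameter $k$, and asks for $\mathrm{ColStrEmb}(\mathcal H_{\phi_k},G,f)$. A parameterised counting problem is a pair $(\Pi,\kappa)$ of a function $\Pi$ from words over a finite alphabet to $\mathbb N_0$ and a polynomial-time computable parameterisation $\kappa$ from words to $\mathbb N_0$. An fpt Turing reduction from $(\Pi,\kappa)$ to $(\Pi',\kappa')$ is an algorithm $A$ with an oracle for $\Pi'$ such that $A$ computes $\Pi$; there are a computable function $f$ and a constant $c$ such that the running time of $A$ on every input $w$ is at most $f(\kappa(w))\,(|w|+1)^c$; and there is a computable function $g$ such that $\kappa'(w')\le g(\kappa(w))$ for every oracle query "$\Pi'(w')=\,?$" posed by $A$ on input $w$. Then, for every family $\Phi$, there is an fpt Turing reduction from p-#Multicolour Induced Subgraph with Property($\Phi$) to p-#Induced Subgraph With Property($\Phi$), where instances are encoded as binary words in a standard way. -/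

import Mathlib

/-! ## Oracle machines with a step count

The machine has finitely many stacks of bits (a program mentions only finitely many of the stacks
`0, 1, 2, …`).  One step pushes a bit, pops a bit, or tests the top of a stack; the finite control is
given in structured form (sequencing, branching, loops).  A Turing machine tape is a pair of stacks
and a stack is a tape with one end, so running times agree with those of multi-tape
(oracle) Turing machines up to constant factors. -/

/-- Programs.  `query i` asks the oracle about the word on stack `i`, which the answer replaces.  The
test `c` of `ite i c p q` and `loop i c p` is applied to the top of stack `i`, which is `none` if
the stack is empty. -/
inductive Prog : Type
  | skip : Prog
  | push (i : ℕ) (b : Bool) : Prog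
  | pop (i : ℕ) : Prog
  | query (i : ℕ) : Prog
  | seq (p q : Prog) : Prog
  | ite (i : ℕ) (c : Option Bool → Bool) (p q : Prog) : Prog
  | loop (i : ℕ) (c : Option Bool → Bool) (p : Prog) : Prog

/-- The contents of all stacks; the head of a list is the top of the stack. -/
abbrev Store : Type := ℕ → List Bool

/-- Initially stack `0` holds the input and all other stacks are empty. -/
def Store.init (w : List Bool) : Store := fun i => if i = 0 then w else []

/-- `Exec O p s s' t qs`: with the oracle `O`, the program `p` started on `s` halts with `s'` after
exactly `t` steps, and `qs` is the list of the oracle queries that it poses.  The oracle answers with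
the binary expansion of its value (least significant bit on top), and a query costs one
step plus the length of the queried word. -/
inductive Exec (O : List Bool → ℕ) : Prog → Store → Store → ℕ → List (List Bool) → Prop
  | skip (s : Store) : Exec O .skip s s 1 []
  | push (i : ℕ) (b : Bool) (s : Store) :
      Exec O (.push i b) s (Function.update s i (b :: s i)) 1 []
  | pop (i : ℕ) (s : Store) :
      Exec O (.pop i) s (Function.update s i (s i).tail) 1 []
  | query (i : ℕ) (s : Store) :
      Exec O (.query i) s (Function.update s i (Nat.bits (O (s i)))) (1 + (s i).length) [s i]
  | seq {p q : Prog} {s s' s'' : Store} {t t' : ℕ} {l l' : List (List Bool)} :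
      Exec O p s s' t l → Exec O q s' s'' t' l' → Exec O (.seq p q) s s'' (t + t') (l ++ l')
  | ite_true {i : ℕ} {c : Option Bool → Bool} {p q : Prog} {s s' : Store} {t : ℕ}
      {l : List (List Bool)} :
      c (s i).head? = true → Exec O p s s' t l → Exec O (.ite i c p q) s s' (t + 1) l
  | ite_false {i : ℕ} {c : Option Bool → Bool} {p q : Prog} {s s' : Store} {t : ℕ}
      {l : List (List Bool)} :
      c (s i).head? = false → Exec O q s s' t l → Exec O (.ite i c p q) s s' (t + 1) l
  | loop_done {i : ℕ} {c : Option Bool → Bool} {p : Prog} {s : Store} :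
      c (s i).head? = false → Exec O (.loop i c p) s s 1 []
  | loop_step {i : ℕ} {c : Option Bool → Bool} {p : Prog} {s s' s'' : Store} {t t' : ℕ}
      {l l' : List (List Bool)} :
      c (s i).head? = true → Exec O p s s' t l → Exec O (.loop i c p) s' s'' t' l' →
      Exec O (.loop i c p) s s'' (t + t' + 1) (l ++ l')

/-- Executions are deterministic. -/
theorem Exec.det {O : List Bool → ℕ} {p : Prog} {s s₁ s₂ : Store} {t₁ t₂ : ℕ}
    {l₁ l₂ : List (List Bool)} (h₁ : Exec O p s s₁ t₁ l₁) (h₂ : Exec O p s s₂ t₂ l₂) :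
    s₁ = s₂ ∧ t₁ = t₂ ∧ l₁ = l₂ := by
  induction h₁ generalizing s₂ t₂ l₂ with
  | skip | push | pop | query => cases h₂; exact ⟨rfl, rfl, rfl⟩
  | seq _ _ ih ih' =>
    cases h₂ with
    | seq a b =>
      obtain ⟨rfl, rfl, rfl⟩ := ih a
      obtain ⟨rfl, rfl, rfl⟩ := ih' b
      exact ⟨rfl, rfl, rfl⟩
  | ite_true hc _ ih =>
    cases h₂ with
    | ite_true _ a => obtain ⟨rfl, rfl, rfl⟩ := ih a; exact ⟨rfl, rfl, rfl⟩
    | ite_false hc' _ => simp [hc] at hc'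
  | ite_false hc _ ih =>
    cases h₂ with
    | ite_true hc' _ => simp [hc] at hc'
    | ite_false _ a => obtain ⟨rfl, rfl, rfl⟩ := ih a; exact ⟨rfl, rfl, rfl⟩
  | loop_done hc =>
    cases h₂ with
    | loop_done _ => exact ⟨rfl, rfl, rfl⟩
    | loop_step hc' _ _ => simp [hc] at hc'
  | loop_step hc _ _ ih ih' =>
    cases h₂ with
    | loop_done hc' => simp [hc] at hc'
    | loop_step _ a b =>
      obtain ⟨rfl, rfl, rfl⟩ := ih a
      obtain ⟨rfl, rfl, rfl⟩ := ih' b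
      exact ⟨rfl, rfl, rfl⟩

/-- `h` is computed, with output in binary on stack `0`, by a program that poses no oracle query and
runs in polynomial time. -/
def PolyTimeComputable (h : List Bool → ℕ) : Prop :=
  ∃ (p : Prog) (c : ℕ), ∀ w : List Bool, ∃ (s : Store) (t : ℕ),
    Exec (fun _ => 0) p (Store.init w) s t [] ∧ s 0 = Nat.bits (h w) ∧
      t ≤ c * (w.length + 1) ^ c

/-! ## Parameterised counting problems and fpt Turing reductions -/

/-- A parameterised counting problem over the alphabet `{0, 1}`. -/
structure ParamCountingProblem where
  count : List Bool → ℕ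
  param : List Bool → ℕ
  param_polyTime : PolyTimeComputable param

/-- `P ≤ Q` under fpt Turing reductions: some program `p` with an oracle for `Q.count` computes
`P.count`, its running time on `w` is at most `f (P.param w) * (|w| + 1) ^ c`, and each word `q` that
it queries on input `w` has `Q.param q ≤ g (P.param w)`. -/
def FptTuringReducible (P Q : ParamCountingProblem) : Prop :=
  ∃ (p : Prog) (f g : ℕ → ℕ) (c : ℕ), Computable f ∧ Computable g ∧
    ∀ w : List Bool, ∃ (s : Store) (t : ℕ) (qs : List (List Bool)),
      Exec Q.count p (Store.init w) s t qs ∧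
      s 0 = Nat.bits (P.count w) ∧
      t ≤ f (P.param w) * (w.length + 1) ^ c ∧
      ∀ q ∈ qs, Q.param q ≤ g (P.param w)

/-! ## Counting labelled induced subgraphs -/

/-- Labelled graphs on the vertex set `[k]`: a graph together with a bijection from the labels
`[k]` to its vertices. -/
abbrev LabelledGraph (k : ℕ) : Type := SimpleGraph (Fin k) × Equiv.Perm (Fin k)

/-- A family of functions `φ_k` from labelled graphs on `[k]` to `{0, 1}`.  Only the `φ_k`
with `1 ≤ k` play a role below. -/
abbrev PropertyFamily : Type := (k : ℕ) → LabelledGraph k → Bool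

/-- The labelled graphs on `[k]` with the property `φ_k`. -/
def PropertyFamily.graphs (Φ : PropertyFamily) (k : ℕ) : Set (LabelledGraph k) :=
  {H | Φ k H = true}

/-- `θ` is a strong embedding into `G` of some member of `ℋ`. -/
def IsStrongEmbedding {V : Type} {k : ℕ} (ℋ : Set (LabelledGraph k)) (G : SimpleGraph V)
    (θ : Fin k → V) : Prop :=
  Function.Injective θ ∧
    ∃ H ∈ ℋ, ∀ i j : Fin k, G.Adj (θ i) (θ j) ↔ H.1.Adj (H.2 i) (H.2 j)

/-- `U` is colourful under `f`: it contains exactly one vertex of each colour. -/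
def IsColourful {V : Type} {k : ℕ} (f : V → Fin k) (U : Set V) : Prop :=
  ∀ i : Fin k, ∃! v, v ∈ U ∧ f v = i

/-- The number of strong embeddings of members of `ℋ` into `G`. -/
noncomputable def strEmb {V : Type} {k : ℕ} (ℋ : Set (LabelledGraph k)) (G : SimpleGraph V) : ℕ :=
  Set.ncard {θ : Fin k → V | IsStrongEmbedding ℋ G θ}

/-- The number of strong embeddings of members of `ℋ` into `G` with colourful image. -/
noncomputable def colStrEmb {V : Type} {k : ℕ} (ℋ : Set (LabelledGraph k)) (G : SimpleGraph V)
    (f : V → Fin k) : ℕ :=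
  Set.ncard {θ : Fin k → V | IsStrongEmbedding ℋ G θ ∧ IsColourful f (Set.range θ)}

/-! ## Instances and their encodings as words -/

/-- A finite graph and a positive integer `k`. -/
structure UncolouredInstance where
  k : ℕ
  k_pos : 1 ≤ k
  n : ℕ
  graph : SimpleGraph (Fin n)

/-- A finite graph, a positive integer `k`, and a colouring of the vertices with `k` colours. -/
structure ColouredInstance where
  k : ℕ
  k_pos : 1 ≤ k
  n : ℕ
  graph : SimpleGraph (Fin n)
  colour : Fin n → Fin k

/-- The word `1^m 0`. -/
def unary (m : ℕ) : List Bool := List.replicate m true ++ [false]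

open Classical in
/-- The adjacency matrix below the diagonal, row by row. -/
noncomputable def graphBits {n : ℕ} (G : SimpleGraph (Fin n)) : List Bool :=
  (List.finRange n).flatMap fun v =>
    (List.finRange v.val).map fun u => decide (G.Adj (u.castLE v.isLt.le) v)

/-- The colours of the vertices, in order. -/
def colourBits {n k : ℕ} (f : Fin n → Fin k) : List Bool :=
  (List.finRange n).flatMap fun v => unary (f v).val

/-- The parameter is written in unary.  This changes the length of an instance only by a factor
bounded in terms of the parameter. -/
noncomputable def UncolouredInstance.encode (x : UncolouredInstance) : List Bool :=
  unary x.k ++ (unary x.n ++ graphBits x.graph)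

noncomputable def ColouredInstance.encode (x : ColouredInstance) : List Bool :=
  unary x.k ++ (unary x.n ++ (colourBits x.colour ++ graphBits x.graph))

theorem unary_append_inj {a b : ℕ} {x y : List Bool} (h : unary a ++ x = unary b ++ y) :
    a = b ∧ x = y := by
  induction a generalizing b with
  | zero => cases b <;> simp_all [unary, List.replicate_succ]
  | succ a ih =>
    cases b with
    | zero => simp [unary, List.replicate_succ] at h
    | succ b =>
      have h' : unary a ++ x = unary b ++ y := by
        simpa [unary, List.replicate_succ] using h
      obtain ⟨rfl, rfl⟩ := ih h'
      exact ⟨rfl, rfl⟩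

theorem flatMap_unary_append_inj {α : Type} (L : List α) {f g : α → ℕ} {x y : List Bool}
    (h : (L.flatMap fun v => unary (f v)) ++ x = (L.flatMap fun v => unary (g v)) ++ y) :
    (∀ v ∈ L, f v = g v) ∧ x = y := by
  induction L with
  | nil => simpa using h
  | cons a L ih =>
    simp only [List.flatMap_cons, List.append_assoc] at h
    obtain ⟨h1, h2⟩ := unary_append_inj h
    obtain ⟨h3, h4⟩ := ih h2
    exact ⟨by simpa [h1] using h3, h4⟩

theorem flatMap_inj_of_length {α : Type} (L : List α) {f g : α → List Bool}
    (hl : ∀ v, (f v).length = (g v).length) (h : L.flatMap f = L.flatMap g) :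
    ∀ v ∈ L, f v = g v := by
  induction L with
  | nil => simp
  | cons a L ih =>
    simp only [List.flatMap_cons] at h
    obtain ⟨h1, h2⟩ := List.append_inj h (hl a)
    simpa [h1] using ih h2

theorem graphBits_injective {n : ℕ} : Function.Injective (graphBits (n := n)) := by
  intro G H h
  have key := flatMap_inj_of_length (List.finRange n) (by simp) h
  have lt : ∀ u v : Fin n, u < v → (G.Adj u v ↔ H.Adj u v) := by
    intro u v huv
    have h1 := key v (List.mem_finRange v)
    have h2 := List.map_inj_left.mp h1 ⟨u.val, huv⟩ (List.mem_finRange _)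
    simpa using h2
  ext u v
  rcases lt_trichotomy u v with huv | rfl | huv
  · exact lt u v huv
  · simp
  · rw [G.adj_comm, H.adj_comm]; exact lt v u huv

theorem UncolouredInstance.encode_injective : Function.Injective UncolouredInstance.encode := by
  rintro ⟨k, hk, n, G⟩ ⟨k', hk', n', G'⟩ h
  obtain ⟨h1, h⟩ := unary_append_inj h
  obtain ⟨h2, h⟩ := unary_append_inj h
  dsimp only at h1 h2
  subst h1 h2
  obtain rfl := graphBits_injective h
  rfl

theorem ColouredInstance.encode_injective : Function.Injective ColouredInstance.encode := by
  rintro ⟨k, hk, n, G, f⟩ ⟨k', hk', n', G', f'⟩ h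
  obtain ⟨h1, h⟩ := unary_append_inj h
  obtain ⟨h2, h⟩ := unary_append_inj h
  dsimp only at h1 h2
  subst h1 h2
  obtain ⟨h3, h⟩ := flatMap_unary_append_inj _ h
  obtain rfl := graphBits_injective h
  obtain rfl : f = f' := funext fun v => Fin.ext (h3 v (List.mem_finRange v))
  rfl

/-- The parameter read off a word: the length of its longest prefix of ones. -/
def leadingOnes (w : List Bool) : ℕ := (w.takeWhile id).length

theorem leadingOnes_unary_append (m : ℕ) (x : List Bool) : leadingOnes (unary m ++ x) = m := by
  induction m with
  | zero => simp [unary, leadingOnes]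
  | succ m ih => simp [unary, leadingOnes, List.replicate_succ]

/-! The parameter is computable in polynomial time: a binary counter is incremented once for each
leading `1`. -/

/-- The store with the given contents of the stacks `0`, `1`, `2`. -/
def stk (a b c : List Bool) : Store :=
  fun i => if i = 0 then a else if i = 1 then b else if i = 2 then c else []

theorem stk_update_zero (a b c x : List Bool) : Function.update (stk a b c) 0 x = stk x b c := by
  funext i; by_cases h : i = 0 <;> simp [stk, h]

theorem stk_update_one (a b c x : List Bool) : Function.update (stk a b c) 1 x = stk a x c := by
  funext i; by_cases h : i = 1 <;> simp [stk, h]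

theorem stk_update_two (a b c x : List Bool) : Function.update (stk a b c) 2 x = stk a b x := by
  funext i; by_cases h : i = 2 <;> simp [stk, h]

section ParamProgram

variable {O : List Bool → ℕ} (a b c : List Bool) (x : Bool)

theorem exec_push1 : Exec O (.push 1 x) (stk a b c) (stk a (x :: b) c) 1 [] := by
  simpa [stk_update_one, stk] using Exec.push (O := O) 1 x (stk a b c)

theorem exec_push2 : Exec O (.push 2 x) (stk a b c) (stk a b (x :: c)) 1 [] := by
  simpa [stk_update_two, stk] using Exec.push (O := O) 2 x (stk a b c)

theorem exec_push0 : Exec O (.push 0 x) (stk a b c) (stk (x :: a) b c) 1 [] := by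
  simpa [stk_update_zero, stk] using Exec.push (O := O) 0 x (stk a b c)

theorem exec_pop0 : Exec O (.pop 0) (stk a b c) (stk a.tail b c) 1 [] := by
  simpa [stk_update_zero, stk] using Exec.pop (O := O) 0 (stk a b c)

theorem exec_pop1 : Exec O (.pop 1) (stk a b c) (stk a b.tail c) 1 [] := by
  simpa [stk_update_one, stk] using Exec.pop (O := O) 1 (stk a b c)

theorem exec_pop2 : Exec O (.pop 2) (stk a b c) (stk a b c.tail) 1 [] := by
  simpa [stk_update_two, stk] using Exec.pop (O := O) 2 (stk a b c)

end ParamProgram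

def carryProg : Prog :=
  .loop 1 (fun o => o == some true) (.seq (.pop 1) (.push 2 false))

def uncarryProg : Prog :=
  .loop 2 Option.isSome (.seq (.pop 2) (.push 1 false))

/-- Increments the binary number on stack `1`. -/
def incProg : Prog := .seq carryProg (.seq (.pop 1) (.seq (.push 1 true) uncarryProg))

/-- Replaces the contents of stack `0` by the contents of stack `1`. -/
def finishProg : Prog :=
  .seq (.loop 0 Option.isSome (.pop 0))
    (.seq (.loop 1 Option.isSome
        (.ite 1 (fun o => o == some true) (.seq (.pop 1) (.push 2 true))
          (.seq (.pop 1) (.push 2 false))))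
      (.loop 2 Option.isSome
        (.ite 2 (fun o => o == some true) (.seq (.pop 2) (.push 0 true))
          (.seq (.pop 2) (.push 0 false)))))

def countProg : Prog := .loop 0 (fun o => o == some true) (.seq (.pop 0) incProg)

theorem exec_carry {O : List Bool → ℕ} (a r : List Bool) (hr : r.head? ≠ some true) (m : ℕ) :
    ∀ c, Exec O carryProg (stk a (List.replicate m true ++ r) c)
      (stk a r (List.replicate m false ++ c)) (3 * m + 1) [] := by
  induction m with
  | zero => intro c; exact Exec.loop_done (by simpa [stk] using hr)
  | succ m ih =>
    intro c
    have h := Exec.loop_step (O := O) (i := 1) (c := fun o => o == some true)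
      (s := stk a (List.replicate (m + 1) true ++ r) c) (by simp [stk, List.replicate_succ])
      (Exec.seq (exec_pop1 a _ c) (exec_push2 a _ c false)) (ih (false :: c))
    have e : List.replicate m false ++ false :: c = List.replicate (m + 1) false ++ c := by
      simp [List.replicate_succ']
    rw [e] at h
    have e' : 1 + 1 + (3 * m + 1) + 1 = 3 * (m + 1) + 1 := by ring
    rw [e'] at h
    exact h

theorem exec_uncarry {O : List Bool → ℕ} (a : List Bool) (m : ℕ) :
    ∀ b, Exec O uncarryProg (stk a b (List.replicate m false))
      (stk a (List.replicate m false ++ b) []) (3 * m + 1) [] := by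
  induction m with
  | zero => intro b; exact Exec.loop_done (by simp [stk])
  | succ m ih =>
    intro b
    have h := Exec.loop_step (O := O) (i := 2) (c := Option.isSome)
      (s := stk a b (List.replicate (m + 1) false)) (by simp [stk, List.replicate_succ])
      (Exec.seq (exec_pop2 a b _) (exec_push1 a b _ false)) (ih (false :: b))
    have e : List.replicate m false ++ false :: b = List.replicate (m + 1) false ++ b := by
      simp [List.replicate_succ']
    rw [e] at h
    have e' : 1 + 1 + (3 * m + 1) + 1 = 3 * (m + 1) + 1 := by ring
    rw [e'] at h
    exact h

theorem bits_succ_shape (n : ℕ) : ∃ m r, m ≤ n ∧ Nat.bits n = List.replicate m true ++ r ∧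
    r.head? ≠ some true ∧ Nat.bits (n + 1) = List.replicate m false ++ true :: r.tail := by
  induction n using Nat.strong_induction_on with
  | _ n ih =>
    obtain ⟨j, rfl | rfl⟩ := n.even_or_odd'
    · rcases Nat.eq_zero_or_pos j with rfl | hj
      · exact ⟨0, [], by simp, by simp, by simp, by simp⟩
      · exact ⟨0, false :: Nat.bits j, by simp, Nat.bit0_bits j hj.ne', by simp,
          by simp⟩
    · obtain ⟨m, r, hm, h1, h2, h3⟩ := ih j (by omega)
      refine ⟨m + 1, r, by omega, ?_, h2, ?_⟩
      · rw [Nat.bit1_bits, h1]; simp [List.replicate_succ]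
      · have : 2 * j + 1 + 1 = 2 * (j + 1) := by ring
        rw [this, Nat.bit0_bits _ (by omega), h3]; simp [List.replicate_succ]

theorem bits_length_le (n : ℕ) : (Nat.bits n).length ≤ n := by
  rw [Nat.size_eq_bits_len]
  exact Nat.size_le.mpr Nat.lt_two_pow_self

theorem exec_inc {O : List Bool → ℕ} (a : List Bool) (n : ℕ) : ∃ t, t ≤ 6 * n + 4 ∧
    Exec O incProg (stk a (Nat.bits n) []) (stk a (Nat.bits (n + 1)) []) t [] := by
  obtain ⟨m, r, hm, h1, h2, h3⟩ := bits_succ_shape n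
  rw [h1, h3]
  have h := Exec.seq (exec_carry (O := O) a r h2 m []) (Exec.seq (exec_pop1 a r _)
    (Exec.seq (exec_push1 a r.tail _ true) (by
      simpa using exec_uncarry (O := O) a m (true :: r.tail))))
  exact ⟨_, by omega, h⟩

theorem exec_count {O : List Bool → ℕ} (w : List Bool) : ∀ n, ∃ a t, a.length ≤ w.length ∧
    t ≤ w.length * (6 * (n + w.length) + 6) + 1 ∧
    Exec O countProg (stk w (Nat.bits n) []) (stk a (Nat.bits (n + leadingOnes w)) []) t [] := by
  induction w with
  | nil =>
    intro n
    exact ⟨[], 1, by simp, by simp, Exec.loop_done (by simp [stk])⟩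
  | cons x w ih =>
    intro n
    cases x with
    | false =>
      exact ⟨false :: w, 1, le_rfl, by omega, Exec.loop_done (by simp [stk])⟩
    | true =>
      obtain ⟨t₁, ht₁, h₁⟩ := exec_inc (O := O) w n
      obtain ⟨a, t₂, ha, ht₂, h₂⟩ := ih (n + 1)
      have h := Exec.loop_step (O := O) (i := 0) (c := fun o => o == some true)
        (s := stk (true :: w) (Nat.bits n) []) (by simp [stk])
        (Exec.seq (exec_pop0 (true :: w) _ []) h₁) h₂
      have e : n + 1 + leadingOnes w = n + leadingOnes (true :: w) := by
        simp [leadingOnes]; ring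
      rw [e] at h
      refine ⟨a, _, by simp; omega, ?_, h⟩
      simp only [List.length_cons]
      nlinarith

theorem exec_clear {O : List Bool → ℕ} (a b c : List Bool) :
    Exec O (.loop 0 Option.isSome (.pop 0)) (stk a b c) (stk [] b c) (2 * a.length + 1) [] := by
  induction a with
  | nil => exact Exec.loop_done (by simp [stk])
  | cons x a ih =>
    have h := Exec.loop_step (O := O) (i := 0) (c := Option.isSome)
      (s := stk (x :: a) b c) (by simp [stk]) (exec_pop0 (x :: a) b c) ih
    have e : 1 + (2 * a.length + 1) + 1 = 2 * (x :: a).length + 1 := by simp; ring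
    rw [e] at h
    exact h

theorem exec_move12 {O : List Bool → ℕ} (a b : List Bool) : ∀ c,
    Exec O (.loop 1 Option.isSome
        (.ite 1 (fun o => o == some true) (.seq (.pop 1) (.push 2 true))
          (.seq (.pop 1) (.push 2 false))))
      (stk a b c) (stk a [] (b.reverse ++ c)) (4 * b.length + 1) [] := by
  induction b with
  | nil => intro c; exact Exec.loop_done (by simp [stk])
  | cons x b ih =>
    intro c
    have hb : Exec O (.ite 1 (fun o => o == some true) (.seq (.pop 1) (.push 2 true))
        (.seq (.pop 1) (.push 2 false))) (stk a (x :: b) c) (stk a b (x :: c)) 3 [] := by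
      cases x with
      | true => exact Exec.ite_true (by simp [stk])
                  (Exec.seq (exec_pop1 a (true :: b) c) (exec_push2 a b c true))
      | false => exact Exec.ite_false (by simp [stk])
                  (Exec.seq (exec_pop1 a (false :: b) c) (exec_push2 a b c false))
    have h := Exec.loop_step (O := O) (i := 1) (c := Option.isSome)
      (s := stk a (x :: b) c) (by simp [stk]) hb (ih (x :: c))
    have e : 3 + (4 * b.length + 1) + 1 = 4 * (x :: b).length + 1 := by simp; ring
    rw [e] at h
    simpa using h

theorem exec_move20 {O : List Bool → ℕ} (b c : List Bool) : ∀ a,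
    Exec O (.loop 2 Option.isSome
        (.ite 2 (fun o => o == some true) (.seq (.pop 2) (.push 0 true))
          (.seq (.pop 2) (.push 0 false))))
      (stk a b c) (stk (c.reverse ++ a) b []) (4 * c.length + 1) [] := by
  induction c with
  | nil => intro a; exact Exec.loop_done (by simp [stk])
  | cons x c ih =>
    intro a
    have hb : Exec O (.ite 2 (fun o => o == some true) (.seq (.pop 2) (.push 0 true))
        (.seq (.pop 2) (.push 0 false))) (stk a b (x :: c)) (stk (x :: a) b c) 3 [] := by
      cases x with
      | true => exact Exec.ite_true (by simp [stk])
                  (Exec.seq (exec_pop2 a b (true :: c)) (exec_push0 a b c true))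
      | false => exact Exec.ite_false (by simp [stk])
                  (Exec.seq (exec_pop2 a b (false :: c)) (exec_push0 a b c false))
    have h := Exec.loop_step (O := O) (i := 2) (c := Option.isSome)
      (s := stk a b (x :: c)) (by simp [stk]) hb (ih (x :: a))
    have e : 3 + (4 * c.length + 1) + 1 = 4 * (x :: c).length + 1 := by simp; ring
    rw [e] at h
    simpa using h

theorem leadingOnes_le (w : List Bool) : leadingOnes w ≤ w.length :=
  (List.takeWhile_prefix id).length_le

theorem leadingOnes_polyTime : PolyTimeComputable leadingOnes := by
  refine ⟨.seq countProg finishProg, 20, fun w => ?_⟩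
  obtain ⟨a, t, ha, ht, h⟩ := exec_count (O := fun _ => 0) w 0
  simp only [Nat.zero_add, Nat.zero_bits] at h ht
  have e : Store.init w = stk w [] [] := by
    funext i; simp [Store.init, stk]
  have h' := Exec.seq h (Exec.seq (exec_clear a _ []) (Exec.seq
    (exec_move12 [] (Nat.bits (leadingOnes w)) []) (exec_move20 [] _ [])))
  rw [← e] at h'
  refine ⟨_, _, h', by simp [stk], ?_⟩
  have hl := (bits_length_le (leadingOnes w)).trans (leadingOnes_le w)
  have hp : (w.length + 1) ^ 2 ≤ (w.length + 1) ^ 20 := Nat.pow_le_pow_right (by omega) (by omega)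
  simp only [List.append_nil, List.length_reverse]
  nlinarith

/-! ## The two problems -/

/-- The function on words with value `ans x` on the encoding of an instance `x`, and `0` on every
word that encodes no instance (`enc` is injective in the uses below). -/
noncomputable def countOnWords {I : Type} (enc : I → List Bool) (ans : I → ℕ) :
    List Bool → ℕ :=
  Function.extend enc ans fun _ => 0

/-- Input: a graph `G` and an integer `k`.  Parameter: `k`.  Output: the number of strong embeddings
into `G` of labelled graphs with the property `φ_k`. -/
noncomputable def inducedSubgraphWithProperty (Φ : PropertyFamily) : ParamCountingProblem where
  count := countOnWords UncolouredInstance.encode fun x => strEmb (Φ.graphs x.k) x.graph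
  param := leadingOnes
  param_polyTime := leadingOnes_polyTime

/-- Input: a graph `G`, an integer `k` and a colouring `f` of the vertices with `k` colours.
Parameter: `k`.  Output: the number of strong embeddings with colourful image into `G` of labelled
graphs with the property `φ_k`. -/
noncomputable def multicolourInducedSubgraphWithProperty (Φ : PropertyFamily) :
    ParamCountingProblem where
  count := countOnWords ColouredInstance.encode
    fun x => colStrEmb (Φ.graphs x.k) x.graph x.colour
  param := leadingOnes
  param_polyTime := leadingOnes_polyTime

theorem inducedSubgraphWithProperty_encode (Φ : PropertyFamily) (x : UncolouredInstance) :
    (inducedSubgraphWithProperty Φ).count x.encode = strEmb (Φ.graphs x.k) x.graph ∧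
      (inducedSubgraphWithProperty Φ).param x.encode = x.k :=
  ⟨UncolouredInstance.encode_injective.extend_apply
    (fun x => strEmb (Φ.graphs x.k) x.graph) (fun _ => 0) x, leadingOnes_unary_append _ _⟩

theorem multicolourInducedSubgraphWithProperty_encode (Φ : PropertyFamily)
    (x : ColouredInstance) :
    (multicolourInducedSubgraphWithProperty Φ).count x.encode =
        colStrEmb (Φ.graphs x.k) x.graph x.colour ∧
      (multicolourInducedSubgraphWithProperty Φ).param x.encode = x.k :=
  ⟨ColouredInstance.encode_injective.extend_apply
    (fun x => colStrEmb (Φ.graphs x.k) x.graph x.colour) (fun _ => 0) x, leadingOnes_unary_append _ _⟩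

/-! An injective map θ : [k] → V has colourful image exactly if f ∘ θ maps onto [k]
(`isColourful_range_iff`). For a set S of colours let G_S be the subgraph induced by the vertices
with a colour in S. Whether θ is a strong embedding depends only on the adjacencies inside its
image, so the strong embeddings into G_S are those strong embeddings into G for which f ∘ θ takes
values in S (`strEmb_comap`). Inclusion–exclusion then gives ColStrEmb(G, f) = ∑_S (-1)^(k - |S|)
StrEmb(G_S), whatever the property is (`colStrEmb_eq_sum`). Thus 2^k queries with the same parameter
k suffice.

What remains is to carry this out on the machine with a quadratic cost per query. A set of colours
is a word of k bits, and a binary counter runs through all of them. Partial sums may be negative, so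
the sum is kept modulo 2^(m+1), where m = n(n-1)/2 is the number of matrix entries. Both the answer
and the oracle's replies are at most n! ≤ 2^m (`factorial_le_two_pow_rowsLength`), hence replies fit
in the accumulator and the answer is determined by its residue. The arithmetic is
`bitsValue_ripple`, the whole loop is `runR_sum`.

The matrix of G_S is obtained by marking the vertices with a colour in S and deleting the entries
whose row or column is unmarked (`selectRows_rows`, `runR_filter`, `runR_build`). Since the problem
takes the value 0 on words that encode no instance, the parser has to recognise encodings exactly
(`runR_parse`); for this every word of the right length must be the matrix of some graph
(`exists_graphBits_eq`). -/

/-! ## Time-bounded executions -/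

/-- With the oracle `O`, the program `p` started on `s` halts with `s'` after at most `T` steps, and
each of its oracle queries satisfies `Q`. -/
def Run (O : List Bool → ℕ) (Q : List Bool → Prop) (p : Prog) (s s' : Store) (T : ℕ) : Prop :=
  ∃ t qs, Exec O p s s' t qs ∧ t ≤ T ∧ ∀ q ∈ qs, Q q

namespace Run

variable {O : List Bool → ℕ} {Q : List Bool → Prop} {p q : Prog} {s s' s'' : Store}
  {T T' i : ℕ} {c : Option Bool → Bool}

theorem mono (h : Run O Q p s s' T) (hT : T ≤ T') : Run O Q p s s' T' := by
  obtain ⟨t, qs, h1, h2, h3⟩ := h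
  exact ⟨t, qs, h1, h2.trans hT, h3⟩

theorem skip (s : Store) : Run O Q .skip s s 1 := ⟨1, [], .skip s, le_rfl, by simp⟩

theorem push (i : ℕ) (b : Bool) (s : Store) :
    Run O Q (.push i b) s (Function.update s i (b :: s i)) 1 :=
  ⟨1, [], .push i b s, le_rfl, by simp⟩

theorem pop (i : ℕ) (s : Store) : Run O Q (.pop i) s (Function.update s i (s i).tail) 1 :=
  ⟨1, [], .pop i s, le_rfl, by simp⟩

theorem query (i : ℕ) (s : Store) (h : Q (s i)) :
    Run O Q (.query i) s (Function.update s i (Nat.bits (O (s i)))) (1 + (s i).length) :=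
  ⟨_, _, .query i s, le_rfl, by simpa using h⟩

theorem seq (h : Run O Q p s s' T) (h' : Run O Q q s' s'' T') :
    Run O Q (.seq p q) s s'' (T + T') := by
  obtain ⟨t, l, h1, h2, h3⟩ := h
  obtain ⟨t', l', h1', h2', h3'⟩ := h'
  refine ⟨_, _, .seq h1 h1', by omega, fun x hx => ?_⟩
  rcases List.mem_append.mp hx with hx | hx
  exacts [h3 x hx, h3' x hx]

theorem ite_true (hc : c (s i).head? = true) (h : Run O Q p s s' T) :
    Run O Q (.ite i c p q) s s' (T + 1) := by
  obtain ⟨t, l, h1, h2, h3⟩ := h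
  exact ⟨_, _, .ite_true hc h1, by omega, h3⟩

theorem ite_false (hc : c (s i).head? = false) (h : Run O Q q s s' T) :
    Run O Q (.ite i c p q) s s' (T + 1) := by
  obtain ⟨t, l, h1, h2, h3⟩ := h
  exact ⟨_, _, .ite_false hc h1, by omega, h3⟩

theorem loop_done (hc : c (s i).head? = false) : Run O Q (.loop i c p) s s 1 :=
  ⟨_, _, .loop_done hc, le_rfl, by simp⟩

theorem loop_step (hc : c (s i).head? = true) (h : Run O Q p s s' T)
    (h' : Run O Q (.loop i c p) s' s'' T') : Run O Q (.loop i c p) s s'' (T + T' + 1) := by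
  obtain ⟨t, l, h1, h2, h3⟩ := h
  obtain ⟨t', l', h1', h2', h3'⟩ := h'
  refine ⟨_, _, .loop_step hc h1 h1', by omega, fun x hx => ?_⟩
  rcases List.mem_append.mp hx with hx | hx
  exacts [h3 x hx, h3' x hx]

end Run

/-! ## Registers -/

/-- The contents of the stacks `0, …, 16`, under the names of their uses. -/
structure Regs where
  inp : List Bool
  sub : List Bool
  subT : List Bool
  col : List Bool
  colT : List Bool
  past : List Bool
  pastT : List Bool
  fut : List Bool
  gr : List Bool
  grT : List Bool
  res : List Bool
  cnt : List Bool
  qry : List Bool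
  sgn : List Bool
  acc : List Bool
  err : List Bool
  go : List Bool

namespace Regs

def store (σ : Regs) : Store
  | 0 => σ.inp | 1 => σ.sub | 2 => σ.subT | 3 => σ.col | 4 => σ.colT | 5 => σ.past
  | 6 => σ.pastT | 7 => σ.fut | 8 => σ.gr | 9 => σ.grT | 10 => σ.res | 11 => σ.cnt
  | 12 => σ.qry | 13 => σ.sgn | 14 => σ.acc | 15 => σ.err | 16 => σ.go
  | _ + 17 => []

/-- The stack `i` of `σ` is replaced by `x`. -/
def set (σ : Regs) (i : ℕ) (x : List Bool) : Regs :=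
  match i with
  | 0 => { σ with inp := x } | 1 => { σ with sub := x } | 2 => { σ with subT := x }
  | 3 => { σ with col := x } | 4 => { σ with colT := x } | 5 => { σ with past := x }
  | 6 => { σ with pastT := x } | 7 => { σ with fut := x } | 8 => { σ with gr := x }
  | 9 => { σ with grT := x } | 10 => { σ with res := x } | 11 => { σ with cnt := x }
  | 12 => { σ with qry := x } | 13 => { σ with sgn := x } | 14 => { σ with acc := x }
  | 15 => { σ with err := x } | 16 => { σ with go := x }
  | _ => σ

/-- The bridge from functions on all stacks to records. A record update displays which stacks a
program changes, and different descriptions of one state can then be identified by unfolding. -/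
theorem update_store (σ : Regs) {i : ℕ} (hi : i < 17) (x : List Bool) :
    Function.update σ.store i x = (σ.set i x).store := by
  funext j
  interval_cases i <;>
  · rcases j with _ | _ | _ | _ | _ | _ | _ | _ | _ | _ | _ | _ | _ | _ | _ | _ | _ | j <;> rfl

theorem set_store_self (σ : Regs) {i : ℕ} (hi : i < 17) (x : List Bool) :
    (σ.set i x).store i = x := by
  rw [← update_store σ hi, Function.update_self]

theorem set_store_ne (σ : Regs) {i j : ℕ} (hi : i < 17) (h : j ≠ i) (x : List Bool) :
    (σ.set i x).store j = σ.store j := by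
  rw [← update_store σ hi, Function.update_of_ne h]

theorem set_set (σ : Regs) (i : ℕ) (x y : List Bool) : (σ.set i x).set i y = σ.set i y := by
  rcases i with _ | _ | _ | _ | _ | _ | _ | _ | _ | _ | _ | _ | _ | _ | _ | _ | _ | j <;> rfl

theorem set_comm (σ : Regs) {i j : ℕ} (h : i ≠ j) (x y : List Bool) :
    (σ.set i x).set j y = (σ.set j y).set i x := by
  by_cases hi : i < 17
  · interval_cases i <;>
    · rcases j with _ | _ | _ | _ | _ | _ | _ | _ | _ | _ | _ | _ | _ | _ | _ | _ | _ | j <;>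
        first | rfl | exact absurd rfl h
  · obtain ⟨i, rfl⟩ := Nat.exists_eq_add_of_le (not_lt.mp hi)
    have e : ∀ τ : Regs, τ.set (17 + i) x = τ := fun τ => by rw [Nat.add_comm]; rfl
    rw [e, e]

theorem set_self (σ : Regs) (i : ℕ) : σ.set i (σ.store i) = σ := by
  rcases i with _ | _ | _ | _ | _ | _ | _ | _ | _ | _ | _ | _ | _ | _ | _ | _ | _ | j <;> rfl

end Regs

/-- Executions between stores given by registers. -/
abbrev RunR (O : List Bool → ℕ) (Q : List Bool → Prop) (p : Prog) (σ τ : Regs) (T : ℕ) : Prop :=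
  Run O Q p σ.store τ.store T

/-- Branches on the top of stack `i`, where an empty stack counts as `0`. -/
def bitProg (i : ℕ) (p : Bool → Prog) : Prog := .ite i (fun o => o == some true) (p true) (p false)

/-- Pops the top of stack `i` and branches on it. -/
def takeProg (i : ℕ) (p : Bool → Prog) : Prog := bitProg i fun b => .seq (.pop i) (p b)

/-- Moves the contents of stack `i` to stack `j`, which reverses them. -/
def moveProg (i j : ℕ) : Prog := .loop i Option.isSome (takeProg i fun b => .push j b)

def clearProg (i : ℕ) : Prog := .loop i Option.isSome (.pop i)

/-- Raises the error flag if stack `i` is empty. -/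
def needProg (i : ℕ) : Prog := .ite i Option.isSome .skip (.push 15 true)

namespace RunR

variable {O : List Bool → ℕ} {Q : List Bool → Prop} {p : Prog} {σ τ : Regs} {T i j : ℕ}

theorem push (σ : Regs) (i : ℕ) (b : Bool) (hi : i < 17 := by decide) :
    RunR O Q (.push i b) σ (σ.set i (b :: σ.store i)) 1 := by
  have h := Run.push (O := O) (Q := Q) i b σ.store
  rwa [Regs.update_store σ hi] at h

theorem pop (σ : Regs) (i : ℕ) (hi : i < 17 := by decide) :
    RunR O Q (.pop i) σ (σ.set i (σ.store i).tail) 1 := by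
  have h := Run.pop (O := O) (Q := Q) i σ.store
  rwa [Regs.update_store σ hi] at h

theorem query (σ : Regs) (i : ℕ) (h : Q (σ.store i)) (hi : i < 17 := by decide) :
    RunR O Q (.query i) σ (σ.set i (Nat.bits (O (σ.store i)))) (1 + (σ.store i).length) := by
  have h := Run.query (O := O) (Q := Q) i σ.store h
  rwa [Regs.update_store σ hi] at h

theorem bit {p : Bool → Prog} (b : Bool) (hb : (σ.store i).head?.getD false = b)
    (h : RunR O Q (p b) σ τ T) : RunR O Q (bitProg i p) σ τ (T + 1) := by
  cases b with
  | true => exact Run.ite_true (by revert hb; cases (σ.store i).head? <;> simp) h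
  | false => exact Run.ite_false (by revert hb; cases (σ.store i).head? <;> simp) h

theorem take {p : Bool → Prog} (b : Bool) (hb : (σ.store i).head?.getD false = b)
    (h : RunR O Q (p b) (σ.set i (σ.store i).tail) τ T) (hi : i < 17 := by decide) :
    RunR O Q (takeProg i p) σ τ (T + 2) :=
  (bit b hb (Run.seq (pop σ i hi) h)).mono (by omega)

/-- Each bit costs four steps: the loop test, the branch, the pop and the push. The final 1 is the
failing loop test. -/
theorem move (i j : ℕ) (σ : Regs) (x : List Bool) (hx : σ.store i = x)
    (hi : i < 17 := by decide) (hj : j < 17 := by decide) (hij : i ≠ j := by decide) :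
    RunR O Q (moveProg i j) σ ((σ.set i []).set j (x.reverse ++ σ.store j))
      (4 * x.length + 1) := by
  induction x generalizing σ with
  | nil =>
    have e : (σ.set i []).set j ([].reverse ++ σ.store j) = σ := by
      rw [← hx, Regs.set_self, hx]; exact Regs.set_self σ j
    rw [e]
    exact Run.loop_done (by simp [hx])
  | cons b x ih =>
    have h1 : RunR O Q (takeProg i fun b => .push j b) σ ((σ.set i x).set j (b :: σ.store j)) 3 := by
      refine take b (by simp [hx]) ?_ hi
      have h := push (O := O) (Q := Q) (σ.set i x) j b hj
      rw [Regs.set_store_ne σ hi hij.symm] at h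
      simpa [hx] using h
    have h2 := ih ((σ.set i x).set j (b :: σ.store j))
      (by rw [Regs.set_store_ne _ hj hij, Regs.set_store_self _ hi])
    rw [Regs.set_store_self _ hj, Regs.set_comm _ hij.symm, Regs.set_set, Regs.set_set] at h2
    have h := Run.loop_step (c := Option.isSome) (by simp [hx]) h1 h2
    rw [List.reverse_cons, List.append_assoc]
    exact h.mono (by simp; omega)

theorem clear (i : ℕ) (σ : Regs) (x : List Bool) (hx : σ.store i = x)
    (hi : i < 17 := by decide) :
    RunR O Q (clearProg i) σ (σ.set i []) (2 * x.length + 1) := by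
  induction x generalizing σ with
  | nil =>
    have e : σ.set i [] = σ := by rw [← hx, Regs.set_self]
    rw [e]
    exact Run.loop_done (by simp [hx])
  | cons b x ih =>
    have h1 := pop (O := O) (Q := Q) σ i hi
    simp only [hx, List.tail_cons] at h1
    have h2 := ih (σ.set i x) (Regs.set_store_self _ hi _)
    rw [Regs.set_set] at h2
    exact (Run.loop_step (c := Option.isSome) (by simp [hx]) h1 h2).mono (by simp; omega)

theorem need_some (h : σ.store i ≠ []) : RunR O Q (needProg i) σ σ 2 :=
  Run.ite_true (by simpa [List.isSome_head?] using h) (Run.skip _)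

theorem need_none (h : σ.store i = []) :
    RunR O Q (needProg i) σ { σ with err := true :: σ.err } 2 :=
  Run.ite_false (by simp [h]) (push σ 15 true)

end RunR

/-- The running time of the reduction depends on the parameter through a factor of this form, one
round per set of colours. -/
theorem computable_mul_two_pow (C : ℕ) : Computable fun k : ℕ => C * 2 ^ k :=
  (Primrec.nat_mul.comp (.const C) ((Primrec₂.unpaired'.1 Nat.Primrec.pow).comp
    (.const 2) .id)).to_comp

/-! ## Adjacency matrices as lists of rows -/

/-- For each entry `v` of the second list, the row of the values `A u v` at the entries `u` of the
first list and of the part of the second list before `v`. -/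
def rows {V : Type} (A : V → V → Bool) : List V → List V → List Bool
  | _, [] => []
  | past, v :: l => past.map (fun u => A u v) ++ rows A (past ++ [v]) l

/-- The first argument is the length of the first row. For first row length 0 the value is n(n-1)/2,
the number of pairs of vertices. -/
def rowsLength : ℕ → ℕ → ℕ
  | _, 0 => 0
  | a, n + 1 => a + rowsLength (a + 1) n

/-- The entries of `g` at the marked positions, if `keep` holds. -/
def selectRow (keep : Bool) : List Bool → List Bool → List Bool
  | m :: past, b :: g => if keep && m then b :: selectRow keep past g else selectRow keep past g
  | _, _ => []

/-- The entries of `g`, read as a list of rows, whose row and column are both marked. -/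
def selectRows : List Bool → List Bool → List Bool → List Bool
  | _, [], _ => []
  | past, keep :: fut, g =>
    selectRow keep past (g.take past.length) ++
      selectRows (past ++ [keep]) fut (g.drop past.length)

section Rows

variable {V W : Type}

theorem length_rows (A : V → V → Bool) (past l : List V) :
    (rows A past l).length = rowsLength past.length l.length := by
  induction l generalizing past with
  | nil => rfl
  | cons v l ih => simp [rows, rowsLength, ih]

theorem rowsLength_le (a n : ℕ) : rowsLength a n ≤ n * (a + n) := by
  induction n generalizing a with
  | zero => simp [rowsLength]
  | succ n ih =>
    have := ih (a + 1)
    simp only [rowsLength]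
    nlinarith

theorem rows_map (e : W → V) (A : V → V → Bool) (past l : List W) :
    rows A (past.map e) (l.map e) = rows (fun u v => A (e u) (e v)) past l := by
  induction l generalizing past with
  | nil => rfl
  | cons v l ih =>
    have := ih (past ++ [v])
    simp only [List.map_append, List.map_cons, List.map_nil] at this
    simp [rows, this, Function.comp_def]

/-- Splitting off the last vertex rather than the first keeps the list of earlier vertices fixed,
which suits the construction of a matrix from a word in `exists_rows_eq`. -/
theorem rows_append_singleton (A : V → V → Bool) (past l : List V) (v : V) :
    rows A past (l ++ [v]) = rows A past l ++ (past ++ l).map (fun u => A u v) := by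
  induction l generalizing past with
  | nil => simp [rows]
  | cons w l ih => simp [rows, ih]

theorem rows_congr (A B : V → V → Bool) (past l : List V)
    (h : ∀ u, ∀ v ∈ l, A u v = B u v) : rows A past l = rows B past l := by
  induction l generalizing past with
  | nil => rfl
  | cons v l ih =>
    simp only [rows, h _ v List.mem_cons_self]
    rw [ih _ fun u w hw => h u w (List.mem_cons_of_mem _ hw)]

theorem selectRow_map (keep : Bool) (m A : V → Bool) (past : List V) :
    selectRow keep (past.map m) (past.map A) = if keep then (past.filter m).map A else [] := by
  induction past with
  | nil => cases keep <;> rfl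
  | cons u past ih =>
    simp only [List.map_cons, selectRow, ih]
    cases keep <;> cases h : m u <;> simp [h]

/-- Deleting unmarked vertices commutes with writing the matrix. Hence the matrix of an induced
subgraph can be cut out of the given word using the marks alone. -/
theorem selectRows_rows (m : V → Bool) (A : V → V → Bool) (past l : List V) :
    selectRows (past.map m) (l.map m) (rows A past l) =
      rows A (past.filter m) (l.filter m) := by
  induction l generalizing past with
  | nil => rfl
  | cons v l ih =>
    have := ih (past ++ [v])
    simp only [List.map_append, List.map_cons, List.map_nil] at this
    simp only [List.map_cons, selectRows, rows, List.length_map]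
    rw [List.take_left' (by simp), List.drop_left' (by simp), this, selectRow_map]
    cases h : m v <;> simp [h, rows]

/-- Links the recursive form, which the programs follow, to the indexed form in which `graphBits` is
defined. -/
theorem rows_eq_flatMap_finRange (A : V → V → Bool) (past l : List V) :
    rows A past l = (List.finRange l.length).flatMap fun i =>
      (past ++ l.take i.val).map fun u => A u l[i] := by
  induction l generalizing past with
  | nil => rfl
  | cons v l ih =>
    have e : List.finRange (v :: l).length = 0 :: (List.finRange l.length).map Fin.succ :=
      List.finRange_succ
    rw [e, rows, ih, List.flatMap_cons, List.flatMap_map]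
    simp

/-- The last row belongs to the last vertex alone, so its values can be prescribed without
disturbing the earlier rows. Distinctness of the vertices makes the position `l.idxOf u` in that row
the right one. -/
theorem exists_rows_eq [DecidableEq V] (l : List V) (hl : l.Nodup) (g : List Bool)
    (hg : g.length = rowsLength 0 l.length) : ∃ A : V → V → Bool, rows A [] l = g := by
  induction l using List.reverseRecOn generalizing g with
  | nil =>
    refine ⟨fun _ _ => false, ?_⟩
    simpa [rows, rowsLength, eq_comm] using hg
  | append_singleton l v ih =>
    have hlen : g.length = rowsLength 0 l.length + l.length := by
      have h1 := length_rows (fun _ _ => true) [] (l ++ [v])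
      rw [rows_append_singleton, List.length_append, length_rows] at h1
      simpa [hg] using h1.symm
    have hnd : l.Nodup ∧ v ∉ l := by
      rw [List.nodup_append] at hl
      exact ⟨hl.1, fun hv => hl.2.2 v hv v (by simp) rfl⟩
    obtain ⟨A, hA⟩ := ih hnd.1 (g.take (rowsLength 0 l.length)) (by simp [hlen])
    refine ⟨fun u w => if w = v then (g.drop (rowsLength 0 l.length)).getD (l.idxOf u) false
      else A u w, ?_⟩
    rw [rows_append_singleton, rows_congr _ A, hA]
    · conv_rhs => rw [← List.take_append_drop (rowsLength 0 l.length) g]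
      congr 1
      refine List.ext_getElem (by simp [hlen]) fun i h1 h2 => ?_
      simp only [List.nil_append, List.length_map] at h1
      simp only [List.nil_append, if_true, List.getElem_map, hnd.1.idxOf_getElem]
      rw [List.getD_eq_getElem _ _ h2]
    · intro u w hw
      exact if_neg (ne_of_mem_of_not_mem hw hnd.2)

end Rows

theorem rows_finRange {n : ℕ} (A : Fin n → Fin n → Bool) :
    rows A [] (List.finRange n) = (List.finRange n).flatMap fun v =>
      (List.finRange v.val).map fun u => A (u.castLE v.isLt.le) v := by
  rw [rows_eq_flatMap_finRange, List.flatMap_def, List.flatMap_def]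
  congr 1
  refine List.ext_getElem (by simp) fun i h1 h2 => ?_
  have hi : i < n := by simpa using h1
  simp only [List.getElem_map, List.nil_append]
  refine List.ext_getElem (by simp; omega) fun j h3 h4 => ?_
  simp

open Classical in
theorem graphBits_eq_rows {n : ℕ} (G : SimpleGraph (Fin n)) :
    graphBits G = rows (fun u v => decide (G.Adj u v)) [] (List.finRange n) := by
  rw [rows_finRange, graphBits]

theorem exists_graphBits_eq {n : ℕ} (g : List Bool) (hg : g.length = rowsLength 0 n) :
    ∃ G : SimpleGraph (Fin n), graphBits G = g := by
  obtain ⟨A, hA⟩ := exists_rows_eq (List.finRange n) (List.nodup_finRange n) g (by simpa using hg)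
  -- The word records `A u v` only for `u < v`, so `A` may be cut down to these pairs and
  -- symmetrised.
  refine ⟨SimpleGraph.fromRel fun u v => u < v ∧ A u v = true, ?_⟩
  rw [← hA, rows_finRange, graphBits]
  congr 1
  funext v
  refine List.map_congr_left fun u _ => ?_
  have h : u.castLE v.isLt.le < v := u.isLt
  simp [SimpleGraph.fromRel_adj, h, h.ne, h.not_gt]

theorem graphBits_comap {m n : ℕ} (G : SimpleGraph (Fin n)) (e : Fin m → Fin n) [DecidableRel G.Adj] :
    graphBits (G.comap e) =
      rows (fun u v => decide (G.Adj u v)) [] ((List.finRange m).map e) := by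
  have h := rows_map e (fun u v => decide (G.Adj u v)) [] (List.finRange m)
  rw [List.map_nil] at h
  rw [h, graphBits_eq_rows]
  congr
  funext u v
  simp

theorem length_graphBits {n : ℕ} (G : SimpleGraph (Fin n)) :
    (graphBits G).length = rowsLength 0 n := by
  rw [graphBits_eq_rows, length_rows]; simp

/-! ## Binary numbers -/

/-- The value of a binary number, least significant bit first. -/
def bitsValue : List Bool → ℕ
  | [] => 0
  | b :: l => b.toNat + 2 * bitsValue l

theorem bitsValue_bits (n : ℕ) : bitsValue (Nat.bits n) = n := by
  induction n using Nat.binaryRec' with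
  | zero => simp [bitsValue]
  | bit b n h ih => rw [Nat.bits_append_bit n b h, bitsValue, ih, Nat.bit_val]; ring

theorem bitsValue_lt (l : List Bool) : bitsValue l < 2 ^ l.length := by
  induction l with
  | nil => simp [bitsValue]
  | cons b l ih =>
    simp only [bitsValue, List.length_cons, pow_succ]
    have := b.toNat_le
    omega

theorem bitsValue_append_replicate_false (l : List Bool) (m : ℕ) :
    bitsValue (l ++ List.replicate m false) = bitsValue l := by
  induction l with
  | nil =>
    induction m with
    | zero => rfl
    | succ m ih => simpa [List.replicate_succ, bitsValue] using ih
  | cons b l ih => simp [bitsValue, ih]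

/-- Padding by zeros at the top is the only way in which binary words of equal value differ, and `h`
excludes it. -/
theorem eq_bits_of_getLast (l : List Bool) (h : l.getLast? ≠ some false) :
    l = Nat.bits (bitsValue l) := by
  induction l with
  | nil => simp [bitsValue]
  | cons b l ih =>
    have hl : l.getLast? ≠ some false := by
      cases l with
      | nil => simp
      | cons c l => simpa [List.getLast?_cons_cons] using h
    have e : bitsValue (b :: l) = Nat.bit b (bitsValue l) := by
      rw [bitsValue, Nat.bit_val]; ring
    rw [e, Nat.bits_append_bit, ← ih hl]
    intro h0
    cases l with
    | nil => cases b <;> simp_all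
    | cons c l => exact absurd (ih hl) (by simp [h0])

def majority (a b c : Bool) : Bool := a && b || a && c || b && c

/-- `x` is added to `acc`, or subtracted if `neg` holds, modulo `2 ^ acc.length`; `c` is the carry or
borrow. -/
def ripple (neg : Bool) : Bool → List Bool → List Bool → List Bool
  | _, [], _ => []
  | c, a :: acc, x =>
    (a ^^ x.head?.getD false ^^ c) ::
      ripple neg (majority (a ^^ neg) (x.head?.getD false) c) acc x.tail

theorem length_ripple (neg c : Bool) (acc x : List Bool) :
    (ripple neg c acc x).length = acc.length := by
  induction acc generalizing c x with
  | nil => rfl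
  | cons a acc ih => simp [ripple, ih]

/-- Each digit step preserves the signed total of digit and carry. For subtraction the borrow is the
majority of the negated digit of `acc`, the digit of `x` and the old borrow. Whatever lies beyond
the last digit of `acc` goes into `d`, so `x` may have any length. -/
theorem bitsValue_ripple (neg c : Bool) (acc x : List Bool) : ∃ d : ℤ,
    (bitsValue (ripple neg c acc x) : ℤ) =
      bitsValue acc + (if neg then -1 else 1) * (bitsValue x + c.toNat) + 2 ^ acc.length * d := by
  induction acc generalizing c x with
  | nil => exact ⟨-((if neg then -1 else 1) * (bitsValue x + c.toNat)), by simp [ripple, bitsValue]⟩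
  | cons a acc ih =>
    obtain ⟨d, hd⟩ := ih (majority (a ^^ neg) (x.head?.getD false) c) x.tail
    refine ⟨d, ?_⟩
    have hx : bitsValue x = (x.head?.getD false).toNat + 2 * bitsValue x.tail := by
      cases x <;> simp [bitsValue]
    rw [ripple, bitsValue, bitsValue, hx]
    push_cast
    rw [hd, List.length_cons, pow_succ]
    -- The identity for a single digit, a finite check over the values of `neg`, `c`, `a`, `b`.
    have key : ∀ a b : Bool, ((a ^^ b ^^ c).toNat : ℤ) +
        2 * ((if neg then -1 else 1) * ((majority (a ^^ neg) b c).toNat : ℤ)) =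
        a.toNat + (if neg then -1 else 1) * (b.toNat + c.toNat) := by
      intro a b; clear ih hd; revert neg c a b; decide
    have := key a (x.head?.getD false)
    linear_combination this

/-! ## Subsets of the set of colours -/

/-- The `k` lowest bits of `i`. -/
def lowBits : ℕ → ℕ → List Bool
  | 0, _ => []
  | k + 1, i => i.testBit 0 :: lowBits k (i / 2)

theorem length_lowBits (k i : ℕ) : (lowBits k i).length = k := by
  induction k generalizing i with
  | zero => rfl
  | succ k ih => simp [lowBits, ih]

theorem lowBits_zero (k : ℕ) : lowBits k 0 = List.replicate k false := by
  induction k with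
  | zero => rfl
  | succ k ih => simp [lowBits, ih, List.replicate_succ]

theorem getD_lowBits {k c : ℕ} (i : ℕ) (h : c < k) : (lowBits k i).getD c false = i.testBit c := by
  induction k generalizing i c with
  | zero => omega
  | succ k ih =>
    cases c with
    | zero => simp [lowBits]
    | succ c => simpa [lowBits, Nat.testBit_succ] using ih (i / 2) (by omega)

/-- By `h` some digit is 0, and the carry of the increment stops at the lowest such digit. -/
theorem lowBits_succ {k i : ℕ} (h : i + 1 < 2 ^ k) : ∃ m r,
    lowBits k i = List.replicate m true ++ false :: r ∧
      lowBits k (i + 1) = List.replicate m false ++ true :: r := by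
  induction k generalizing i with
  | zero => simp at h
  | succ k ih =>
    obtain ⟨j, rfl | rfl⟩ := i.even_or_odd'
    · exact ⟨0, lowBits k j, by simp [lowBits], by
        have : (2 * j + 1) / 2 = j := by omega
        simp [lowBits, this]⟩
    · obtain ⟨m, r, h1, h2⟩ := ih (i := j) (by rw [pow_succ] at h; omega)
      refine ⟨m + 1, r, ?_, ?_⟩
      · have : (2 * j + 1) / 2 = j := by omega
        simp [lowBits, this, h1, List.replicate_succ]
      · have e : 2 * j + 1 + 1 = 2 * (j + 1) := by ring
        have : 2 * (j + 1) / 2 = j + 1 := by omega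
        rw [e, lowBits, this, h2]
        simp [List.replicate_succ]

theorem lowBits_last {k i : ℕ} (h : i + 1 = 2 ^ k) : lowBits k i = List.replicate k true := by
  induction k generalizing i with
  | zero => rfl
  | succ k ih =>
    rw [pow_succ] at h
    have h1 : i / 2 + 1 = 2 ^ k := by omega
    have h2 : i.testBit 0 = true := by simp; omega
    rw [lowBits, ih h1, h2, List.replicate_succ]

/-- Whether the number of absent elements is odd, xor `b`. -/
def absentParity : Bool → List Bool → Bool
  | b, [] => b
  | b, m :: S => absentParity (b ^^ !m) S

def absentSign (S : List Bool) : ℤ := if absentParity false S then -1 else 1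

/-- The product form, with one factor for each colour, is what lets the sum over all sets factorise.
-/
theorem absentSign_lowBits (k i : ℕ) :
    absentSign (lowBits k i) = ∏ c ∈ Finset.range k, if i.testBit c then 1 else -1 := by
  have key : ∀ b : Bool, (if absentParity b (lowBits k i) then (-1 : ℤ) else 1) =
      (if b then -1 else 1) * ∏ c ∈ Finset.range k, if i.testBit c then 1 else -1 := by
    induction k generalizing i with
    | zero => simp [lowBits, absentParity]
    | succ k ih =>
      intro b
      rw [lowBits, absentParity, ih, Finset.prod_range_succ']
      simp only [Nat.testBit_succ]
      cases b <;> cases i.testBit 0 <;> simp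
  simpa [absentSign] using key false

theorem sum_range_two_mul (g : ℕ → ℤ) (m : ℕ) :
    ∑ i ∈ Finset.range (2 * m), g i = ∑ j ∈ Finset.range m, (g (2 * j) + g (2 * j + 1)) := by
  induction m with
  | zero => simp
  | succ m ih =>
    rw [Nat.mul_succ, Finset.sum_range_succ, Finset.sum_range_succ, ih, Finset.sum_range_succ]
    ring

/-- Expanding the product on the right means choosing a bit for each `c`, that is, a number below `2
^ k`. The induction splits off the lowest bit. -/
theorem sum_prod_testBit (k : ℕ) (t : ℕ → Bool → ℤ) :
    ∑ i ∈ Finset.range (2 ^ k), ∏ c ∈ Finset.range k, t c (i.testBit c) =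
      ∏ c ∈ Finset.range k, (t c false + t c true) := by
  induction k generalizing t with
  | zero => simp
  | succ k ih =>
    rw [pow_succ', sum_range_two_mul, Finset.prod_range_succ', ← ih fun c => t (c + 1),
      Finset.sum_mul]
    refine Finset.sum_congr rfl fun j _ => ?_
    have h : (2 * j + 1) / 2 = j := by omega
    simp only [Finset.prod_range_succ', Nat.testBit_succ, h]
    simp [mul_add]

/-! ## Inclusion–exclusion over the sets of colours -/

section InclusionExclusion

variable {k : ℕ}

/-- Uniqueness comes for free: a surjection from `Fin k` to itself is injective. -/
theorem isColourful_range_iff {V : Type} {f : V → Fin k} {θ : Fin k → V} :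
    IsColourful f (Set.range θ) ↔ Function.Surjective (f ∘ θ) := by
  constructor
  · intro h i
    obtain ⟨_, ⟨⟨j, rfl⟩, hj⟩, _⟩ := h i
    exact ⟨j, hj⟩
  · intro h i
    obtain ⟨j, hj⟩ := h i
    refine ⟨θ j, ⟨⟨j, rfl⟩, hj⟩, ?_⟩
    rintro _ ⟨⟨j', rfl⟩, hj'⟩
    have hinj : Function.Injective (f ∘ θ) := Finite.injective_iff_surjective.mpr h
    rw [hinj (a₁ := j) (a₂ := j') (hj.trans hj'.symm)]

/-- A strong embedding only sees adjacencies inside its image, so composition with `e` is a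
bijection between the two sets of maps. -/
theorem strEmb_comap {V W : Type} (ℋ : Set (LabelledGraph k)) (G : SimpleGraph V) (e : W → V)
    (he : Function.Injective e) :
    strEmb ℋ (G.comap e) = Set.ncard {θ : Fin k → V | IsStrongEmbedding ℋ G θ ∧
      ∀ j, θ j ∈ Set.range e} := by
  have h : {θ : Fin k → V | IsStrongEmbedding ℋ G θ ∧ ∀ j, θ j ∈ Set.range e} =
      (fun θ : Fin k → W => e ∘ θ) '' {θ | IsStrongEmbedding ℋ (G.comap e) θ} := by
    ext θ
    constructor
    · rintro ⟨⟨h1, h2⟩, h3⟩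
      choose θ' hθ' using h3
      obtain rfl : e ∘ θ' = θ := funext hθ'
      exact ⟨θ', ⟨h1.of_comp, h2⟩, rfl⟩
    · rintro ⟨θ', ⟨h1, h2⟩, rfl⟩
      exact ⟨⟨he.comp h1, h2⟩, fun j => ⟨θ' j, rfl⟩⟩
  rw [h, Set.ncard_image_of_injective _ he.comp_left, strEmb]

/-- Whether the colour of a vertex is in the set of colours `S`. -/
def hasColourIn {V : Type} (f : V → Fin k) (S : List Bool) (v : V) : Bool := S.getD (f v).val false

/-- The subgraph induced by the vertices with a colour in `S`. -/
def ColouredInstance.restrict (x : ColouredInstance) (S : List Bool) : UncolouredInstance where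
  k := x.k
  k_pos := x.k_pos
  n := ((List.finRange x.n).filter (hasColourIn x.colour S)).length
  graph := x.graph.comap ((List.finRange x.n).filter (hasColourIn x.colour S)).get

/-- The term of a set of colours is a product over the colours: a colour in the set contributes 1,
an absent one contributes 0 if `c` uses it and -1 otherwise. The sum is therefore a product of
factors 1 + 0 for used colours and 1 - 1 for unused ones. -/
theorem sum_absentSign_covers {n : ℕ} (c : Fin n → Fin k) :
    ∑ i ∈ Finset.range (2 ^ k), absentSign (lowBits k i) *
      (if ∀ j, hasColourIn c (lowBits k i) j = true then 1 else 0) =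
      if Function.Surjective c then 1 else 0 := by
  classical
  have h1 : ∀ i, absentSign (lowBits k i) *
      (if ∀ j, hasColourIn c (lowBits k i) j = true then 1 else 0) =
      ∏ a ∈ Finset.range k, (fun (a : ℕ) (b : Bool) =>
        if b then (1 : ℤ) else if ∃ j, (c j).val = a then 0 else -1) a (i.testBit a) := by
    intro i
    rw [absentSign_lowBits]
    split_ifs with h
    · rw [mul_one]
      refine Finset.prod_congr rfl fun a _ => ?_
      cases hb : i.testBit a with
      | true => simp
      | false =>
        have : ¬ ∃ j, (c j).val = a := by
          rintro ⟨j, rfl⟩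
          have := h j
          rw [hasColourIn, getD_lowBits _ (c j).isLt, hb] at this
          simp at this
        simp [this]
    · push Not at h
      obtain ⟨j, hj⟩ := h
      rw [hasColourIn, getD_lowBits _ (c j).isLt] at hj
      rw [mul_zero, eq_comm, Finset.prod_eq_zero (Finset.mem_range.mpr (c j).isLt)]
      simp only [Bool.not_eq_true] at hj
      simp [hj]
  refine (Finset.sum_congr rfl fun i _ => h1 i).trans ((sum_prod_testBit k fun a b =>
    if b then (1 : ℤ) else if ∃ j, (c j).val = a then 0 else -1).trans ?_)
  simp only [Bool.false_eq_true, if_false, if_true]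
  split_ifs with h
  · refine Finset.prod_eq_one fun a ha => ?_
    obtain ⟨j, hj⟩ := h ⟨a, Finset.mem_range.mp ha⟩
    rw [if_pos ⟨j, by rw [hj]⟩]; rfl
  · unfold Function.Surjective at h
    push Not at h
    obtain ⟨a, ha⟩ := h
    refine Finset.prod_eq_zero (Finset.mem_range.mpr a.isLt) ?_
    rw [if_neg]
    · rfl
    · rintro ⟨j, hj⟩
      exact ha j (Fin.ext hj)

/-- All counts are sums of indicators over the strong embeddings `θ` into the whole graph. After
exchanging the sums, `sum_absentSign_covers` applies to `x.colour ∘ θ`. -/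
theorem colStrEmb_eq_sum (x : ColouredInstance) (ℋ : Set (LabelledGraph x.k)) :
    (colStrEmb ℋ x.graph x.colour : ℤ) = ∑ i ∈ Finset.range (2 ^ x.k),
      absentSign (lowBits x.k i) * (strEmb ℋ (x.restrict (lowBits x.k i)).graph : ℕ) := by
  classical
  have h1 : ∀ S, (strEmb ℋ (x.restrict S).graph : ℤ) =
      ∑ θ ∈ Finset.univ.filter fun θ => IsStrongEmbedding ℋ x.graph θ,
        if ∀ j, hasColourIn (x.colour ∘ θ) S j = true then 1 else 0 := by
    intro S
    rw [ColouredInstance.restrict]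
    have hnd : ((List.finRange x.n).filter (hasColourIn x.colour S)).Nodup :=
      (List.nodup_finRange _).filter _
    rw [strEmb_comap ℋ x.graph _ (List.nodup_iff_injective_get.mp hnd), Finset.sum_boole,
      Finset.filter_filter, ← Set.ncard_coe_finset]
    congr 2
    ext θ
    simp [hasColourIn]
  simp only [h1, Finset.mul_sum]
  rw [Finset.sum_comm]
  simp only [sum_absentSign_covers]
  rw [Finset.sum_boole, Finset.filter_filter, ← Set.ncard_coe_finset, colStrEmb]
  congr 2
  ext θ
  simp [isColourful_range_iff]

/-- The factorial is the product of `a + 1` over `a < n`, the row with index `a` has `a` entries,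
and `a + 1 ≤ 2 ^ a`. -/
theorem factorial_le_two_pow_rowsLength (n : ℕ) : n.factorial ≤ 2 ^ rowsLength 0 n := by
  have h : ∀ a n, (a + n).factorial ≤ a.factorial * 2 ^ rowsLength a n := by
    intro a n
    induction n generalizing a with
    | zero => simp [rowsLength]
    | succ n ih =>
      have h1 := ih (a + 1)
      have h2 : a + 1 ≤ 2 ^ a := Nat.lt_two_pow_self
      rw [rowsLength, pow_add, ← add_assoc, add_right_comm]
      refine h1.trans ?_
      rw [Nat.factorial_succ, ← mul_assoc, mul_comm (a + 1)]
      gcongr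
  simpa using h 0 n

/-- The number of injections is a descending factorial of the number of vertices. The bound does not
involve `k`, so the width of the accumulator can be read off the matrix. -/
theorem ncard_le_factorial {V : Type} [Fintype V] (s : Set (Fin k → V))
    (hs : ∀ θ ∈ s, Function.Injective θ) : s.ncard ≤ (Fintype.card V).factorial := by
  classical
  have h1 : s.ncard ≤ Fintype.card (Fin k ↪ V) := by
    rw [← Nat.card_eq_fintype_card, ← Nat.card_coe_set_eq]
    refine Nat.card_le_card_of_injective (fun θ : s => ⟨θ.1, hs θ.1 θ.2⟩) fun a b h => ?_
    exact Subtype.ext (congrArg (fun e : Fin k ↪ V => (e : Fin k → V)) h)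
  refine h1.trans ?_
  rw [Fintype.card_embedding_eq, Fintype.card_fin]
  rcases le_or_gt k (Fintype.card V) with h | h
  · rw [← Nat.factorial_mul_descFactorial h]
    exact Nat.le_mul_of_pos_left _ (Nat.factorial_pos _)
  · rw [Nat.descFactorial_of_lt h]; exact Nat.zero_le _

/-- Makes the answer recoverable from its residue modulo this power of two. -/
theorem colStrEmb_lt {n : ℕ} (ℋ : Set (LabelledGraph k)) (G : SimpleGraph (Fin n))
    (f : Fin n → Fin k) : colStrEmb ℋ G f < 2 ^ ((graphBits G).length + 1) := by
  have h1 := ncard_le_factorial {θ : Fin k → Fin n | IsStrongEmbedding ℋ G θ ∧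
    IsColourful f (Set.range θ)} fun θ h => h.1.1
  rw [Fintype.card_fin] at h1
  rw [length_graphBits, pow_succ]
  have := factorial_le_two_pow_rowsLength n
  have : 0 < 2 ^ rowsLength 0 n := by positivity
  unfold colStrEmb
  omega

/-- Ensures that the addition uses up every digit of the oracle's reply and leaves stack 12 empty,
as `runR_ripple` requires. -/
theorem length_bits_strEmb_le (x : ColouredInstance) (S : List Bool)
    (ℋ : Set (LabelledGraph x.k)) :
    (Nat.bits (strEmb ℋ (x.restrict S).graph)).length ≤ (graphBits x.graph).length + 1 := by
  have h1 := ncard_le_factorial {θ | IsStrongEmbedding ℋ (x.restrict S).graph θ} fun θ h => h.1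
  rw [Fintype.card_fin] at h1
  have h2 : (x.restrict S).n ≤ x.n := by
    rw [ColouredInstance.restrict]
    exact (List.length_filter_le _ _).trans (by simp)
  have h3 := (Nat.factorial_le h2).trans (factorial_le_two_pow_rowsLength x.n)
  rw [Nat.size_eq_bits_len, Nat.size_le, length_graphBits, pow_succ]
  have : 0 < 2 ^ rowsLength 0 x.n := by positivity
  unfold strEmb
  omega

end InclusionExclusion

open Classical in
theorem ColouredInstance.encode_restrict (x : ColouredInstance) (S : List Bool) :
    (x.restrict S).encode = unary x.k ++ (unary (x.restrict S).n ++
      rows (fun u v => decide (x.graph.Adj u v)) []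
        ((List.finRange x.n).filter (hasColourIn x.colour S))) := by
  rw [UncolouredInstance.encode]
  congr 2
  exact (graphBits_comap x.graph _).trans (congrArg (rows _ []) (List.map_get_finRange _))

/-! ## Filtering an adjacency matrix -/

/-- Reads one row of the matrix on stack `8`; the marks of its entries are on stack `5`. -/
def filterRowProg (keep : Bool) : Prog :=
  .loop 5 Option.isSome (takeProg 5 fun m => .seq (.push 6 m) (.seq (needProg 8)
    (takeProg 8 fun g => .seq (.push 9 g) (if keep && m then .push 10 g else .skip))))

/-- Appends to stack `10` the entries of the matrix on stack `8` whose row and column are marked on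
stack `7`, and raises the error flag if that matrix is too short. -/
def filterProg : Prog :=
  .loop 7 Option.isSome (takeProg 7 fun keep => .seq (filterRowProg keep) (.seq (.push 6 keep)
    (.seq (if keep then .push 11 true else .skip) (moveProg 6 5))))

section Programs

variable {O : List Bool → ℕ} {Q : List Bool → Prop}

/-- The convention for errors from here on: `e` is what a program pushes on the error stack, and it
is empty exactly if no check failed. -/
theorem runR_need (σ : Regs) (i : ℕ) : ∃ e,
    RunR O Q (needProg i) σ { σ with err := e ++ σ.err } 2 ∧ (e = [] ↔ σ.store i ≠ []) := by
  by_cases h : σ.store i = []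
  · exact ⟨[true], RunR.need_none h, by simp [h]⟩
  · exact ⟨[], RunR.need_some h, by simp [h]⟩

/-- The program does not stop at an error. Missing bits are read as 0, so `g` always has full
length, and `e` tells whether `g` was really present on stack 8. -/
theorem runR_filterRow (keep : Bool) (past : List Bool) : ∀ σ : Regs, ∃ g r e,
    g.length = past.length ∧
      RunR O Q (filterRowProg keep) { σ with past := past }
        { σ with
          past := []
          pastT := past.reverse ++ σ.pastT
          gr := r
          grT := g.reverse ++ σ.grT
          res := (selectRow keep past g).reverse ++ σ.res
          err := e ++ σ.err } (10 * past.length + 1) ∧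
      (e = [] → σ.gr = g ++ r) ∧ (e ≠ [] → σ.gr.length < past.length) := by
  induction past with
  | nil => exact fun σ => ⟨[], σ.gr, [], rfl, Run.loop_done rfl, by simp, by simp⟩
  | cons m past ih =>
    intro σ
    obtain ⟨e₁, hneed, he₁⟩ := runR_need (O := O) (Q := Q)
      { σ with past := past, pastT := m :: σ.pastT } 8
    obtain ⟨b, hb⟩ : ∃ b, σ.gr.head?.getD false = b := ⟨_, rfl⟩
    have hlast : RunR O Q (if keep && m then .push 10 b else .skip)
        { σ with past := past, pastT := m :: σ.pastT, err := e₁ ++ σ.err, gr := σ.gr.tail,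
                 grT := b :: σ.grT }
        { σ with past := past, pastT := m :: σ.pastT, err := e₁ ++ σ.err, gr := σ.gr.tail,
                 grT := b :: σ.grT, res := (if keep && m then [b] else []) ++ σ.res } 1 := by
      cases keep && m with
      | true => exact RunR.push _ 10 b
      | false => exact Run.skip _
    have hbody := RunR.take (O := O) (Q := Q) (σ := { σ with past := m :: past }) (i := 5)
      (p := fun m => .seq (.push 6 m) (.seq (needProg 8)
        (takeProg 8 fun g => .seq (.push 9 g) (if keep && m then .push 10 g else .skip))))
      m rfl
      (Run.seq (RunR.push _ 6 m) (Run.seq hneed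
        (RunR.take (i := 8) b hb (Run.seq (RunR.push _ 9 b) hlast))))
    obtain ⟨g, r, e₂, hg, hrun, h1, h2⟩ := ih
      { σ with past := past, pastT := m :: σ.pastT, err := e₁ ++ σ.err, gr := σ.gr.tail,
               grT := b :: σ.grT, res := (if keep && m then [b] else []) ++ σ.res }
    refine ⟨b :: g, r, e₂ ++ e₁, by simp [hg], ?_, ?_, ?_⟩
    · have hstep := Run.loop_step (c := Option.isSome) (i := 5) rfl hbody hrun
      have hsel : (selectRow keep (m :: past) (b :: g)).reverse ++ σ.res =
          (selectRow keep past g).reverse ++ ((if keep && m then [b] else []) ++ σ.res) := by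
        rw [selectRow]; cases keep && m <;> simp
      rw [hsel]
      simp only [List.reverse_cons, List.append_assoc, List.singleton_append]
      exact hstep.mono (by simp; omega)
    · intro he
      rw [List.append_eq_nil_iff] at he
      have hne : σ.gr ≠ [] := he₁.mp he.2
      have := h1 he.1
      obtain ⟨a, l, hl⟩ := List.exists_cons_of_ne_nil hne
      simp only [hl, List.tail_cons] at this hb ⊢
      simp_all
    · intro he
      simp only [List.length_cons]
      by_cases hne : σ.gr = []
      · simp [hne]
      · have : e₂ ≠ [] := fun h0 => he (by rw [h0, he₁.mpr hne]; rfl)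
        have := h2 this
        simp only [List.length_tail] at this
        omega

/-- Stated for arbitrary contents of stack 8 because it serves twice: to extract a submatrix from a
valid matrix, and, with all marks set, to measure the length of an unchecked one. -/
theorem runR_filter (fut : List Bool) : ∀ (past : List Bool) (σ : Regs), ∃ g r e,
    g.length = rowsLength past.length fut.length ∧
      RunR O Q filterProg { σ with past := past, pastT := [], fut := fut }
        { σ with
          past := past ++ fut
          pastT := []
          fut := []
          gr := r
          grT := g.reverse ++ σ.grT
          res := (selectRows past fut g).reverse ++ σ.res
          cnt := List.replicate (fut.count true) true ++ σ.cnt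
          err := e ++ σ.err } (fut.length * (14 * (past.length + fut.length) + 12) + 1) ∧
      (e = [] → σ.gr = g ++ r) ∧
      (e ≠ [] → σ.gr.length < rowsLength past.length fut.length) := by
  induction fut with
  | nil =>
    intro past σ
    refine ⟨[], σ.gr, [], rfl, ?_, by simp, by simp⟩
    rw [List.append_nil]
    exact (Run.loop_done rfl : Run O Q filterProg _ _ 1).mono (by omega)
  | cons keep fut ih =>
    intro past σ
    obtain ⟨g₁, r₁, e₁, hg₁, hrow, h1, h1'⟩ := runR_filterRow (O := O) (Q := Q) keep past
      { σ with pastT := [], fut := fut }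
    obtain ⟨g₂, r₂, e₂, hg₂, hrun, h2, h2'⟩ := ih (past ++ [keep])
      { σ with
        gr := r₁
        grT := g₁.reverse ++ σ.grT
        res := (selectRow keep past g₁).reverse ++ σ.res
        cnt := (if keep then [true] else []) ++ σ.cnt
        err := e₁ ++ σ.err }
    have hcnt : RunR O Q (if keep then .push 11 true else .skip)
        { σ with
          past := []
          pastT := keep :: (past.reverse ++ [])
          fut := fut
          gr := r₁
          grT := g₁.reverse ++ σ.grT
          res := (selectRow keep past g₁).reverse ++ σ.res
          err := e₁ ++ σ.err }
        { σ with
          past := []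
          pastT := keep :: (past.reverse ++ [])
          fut := fut
          gr := r₁
          grT := g₁.reverse ++ σ.grT
          res := (selectRow keep past g₁).reverse ++ σ.res
          cnt := (if keep then [true] else []) ++ σ.cnt
          err := e₁ ++ σ.err } 1 := by
      cases keep with
      | true => exact RunR.push _ 11 true
      | false => exact Run.skip _
    have hmove := RunR.move (O := O) (Q := Q) 6 5
      { σ with
          past := []
          pastT := keep :: (past.reverse ++ [])
          fut := fut
          gr := r₁
          grT := g₁.reverse ++ σ.grT
          res := (selectRow keep past g₁).reverse ++ σ.res
          cnt := (if keep then [true] else []) ++ σ.cnt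
          err := e₁ ++ σ.err } (keep :: (past.reverse ++ [])) rfl
    -- Moving the marks back undoes the reversal caused by reading the row and puts the new mark at
    -- the end, ready for the next, longer row.
    have e5 : (keep :: (past.reverse ++ [])).reverse ++ ([] : List Bool) = past ++ [keep] := by simp
    simp only [Regs.set, Regs.store, e5] at hmove
    have hbody := RunR.take (O := O) (Q := Q) (i := 7)
      (σ := { σ with past := past, pastT := [], fut := keep :: fut })
      (p := fun keep => .seq (filterRowProg keep) (.seq (.push 6 keep)
        (.seq (if keep then .push 11 true else .skip) (moveProg 6 5)))) keep rfl
      (Run.seq hrow (Run.seq (RunR.push _ 6 keep) (Run.seq hcnt hmove)))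
    have hstep := Run.loop_step (c := Option.isSome) (i := 7) rfl hbody hrun
    refine ⟨g₁ ++ g₂, r₂, e₂ ++ e₁, ?_, ?_, ?_, ?_⟩
    · simp only [List.length_append, List.length_singleton] at hg₂
      rw [List.length_append, hg₁, hg₂, List.length_cons, rowsLength]
    · have hsel : (selectRows past (keep :: fut) (g₁ ++ g₂)).reverse ++ σ.res =
          (selectRows (past ++ [keep]) fut g₂).reverse ++
            ((selectRow keep past g₁).reverse ++ σ.res) := by
        rw [selectRows, List.take_left' hg₁, List.drop_left' hg₁]; simp
      have hc : List.replicate ((keep :: fut).count true) true ++ σ.cnt =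
          List.replicate (fut.count true) true ++ ((if keep then [true] else []) ++ σ.cnt) := by
        cases keep <;> simp [List.replicate_succ']
      rw [hsel, hc]
      rw [List.append_assoc, List.singleton_append] at hstep
      simp only [List.reverse_append, List.append_assoc]
      exact hstep.mono (by simp; nlinarith)
    · intro he
      rw [List.append_eq_nil_iff] at he
      rw [List.append_assoc, ← h2 he.1]
      exact h1 he.2
    · intro he
      simp only [List.length_append, List.length_singleton] at h2'
      simp only [List.length_cons, rowsLength]
      by_cases h0 : e₁ = []
      · have h3 := h2' fun h => he (by rw [h, h0]; rfl)
        have h4 := congrArg List.length (h1 h0)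
        simp only [List.length_append] at h4
        omega
      · have := h1' h0
        simp only at this
        omega

end Programs

/-! ## Marking the vertices with a colour in a set -/

/-- Moves a run of ones from stack `3` to stack `4` and as many entries from stack `1` to stack `2`. -/
def seekProg : Prog :=
  .loop 3 (fun o => o == some true)
    (.seq (.pop 3) (.seq (.push 4 true) (takeProg 1 fun b => .push 2 b)))

/-- Writes to stack `7` which of the colours listed on stack `3` belong to the set on stack `1`. -/
def markProg : Prog :=
  .seq (.loop 3 Option.isSome (.seq seekProg (.seq (.pop 3) (.seq (.push 4 false)
    (.seq (bitProg 1 fun b => .push 6 b) (moveProg 2 1))))))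
    (.seq (moveProg 4 3) (moveProg 6 7))

/-- Appends `1 ^ k` to the query and flips the bit on stack `13` for each absent colour. -/
def signProg : Prog :=
  .loop 1 Option.isSome (takeProg 1 fun b => .seq (.push 2 b) (.seq (.push 12 true)
    (if b then .skip else takeProg 13 fun f => .push 13 !f)))

/-- Adds the number on stack `12` to that on stack `14`, or subtracts it, as stack `13` says. -/
def rippleProg : Prog :=
  .seq (.loop 14 Option.isSome (takeProg 14 fun a => takeProg 12 fun b => takeProg 6 fun c =>
    bitProg 13 fun f => .seq (.push 10 (a ^^ b ^^ c)) (.push 6 (majority (a ^^ f) b c))))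
    (.seq (.pop 6) (.seq (.pop 13) (moveProg 10 14)))

/-- Increments the binary number on stack `1`, and empties stack `16` on overflow. -/
def nextProg : Prog :=
  .seq (.loop 1 (fun o => o == some true) (.seq (.pop 1) (.push 2 false)))
    (.seq (.ite 1 Option.isSome (.seq (.pop 1) (.push 1 true)) (.pop 16)) (moveProg 2 1))

/-- Writes to stack `12` the instance induced by the colours on stack `1`. -/
def buildProg : Prog :=
  .seq markProg (.seq filterProg (.seq (clearProg 5) (.seq (moveProg 9 8) (.seq (moveProg 10 12)
    (.seq (.push 12 false) (.seq (moveProg 11 12) (.seq (.push 12 false) (.seq (.push 13 false)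
      (.seq signProg (moveProg 2 1))))))))))

def sumProg : Prog :=
  .loop 16 Option.isSome (.seq buildProg (.seq (.query 12) (.seq rippleProg nextProg)))

section Programs

variable {O : List Bool → ℕ} {Q : List Bool → Prop}

/-- Reading the colour in unary brings its entry of the set to the top of stack 1; the entries
passed over wait on stack 2. -/
theorem runR_seek (c : ℕ) (rest : List Bool) : ∀ (S : List Bool) (σ : Regs), c ≤ S.length →
    RunR O Q seekProg { σ with col := List.replicate c true ++ false :: rest, sub := S }
      { σ with
        col := false :: rest
        colT := List.replicate c true ++ σ.colT
        sub := S.drop c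
        subT := (S.take c).reverse ++ σ.subT } (6 * c + 1) := by
  induction c with
  | zero => exact fun S σ _ => Run.loop_done rfl
  | succ c ih =>
    intro S σ hS
    obtain ⟨b, S, rfl⟩ := List.exists_cons_of_length_pos (by omega : 0 < S.length)
    have hbody := Run.seq (RunR.pop (O := O) (Q := Q)
      { σ with col := List.replicate (c + 1) true ++ false :: rest, sub := b :: S } 3)
      (Run.seq (RunR.push _ 4 true) (RunR.take (i := 1) (p := fun b => .push 2 b) b rfl
        (RunR.push _ 2 b)))
    have h := Run.loop_step (c := fun o => o == some true) (i := 3) rfl hbody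
      (ih S { σ with colT := true :: σ.colT, subT := b :: σ.subT } (by simpa using hS))
    have e1 : List.replicate (c + 1) true ++ σ.colT = List.replicate c true ++ true :: σ.colT := by
      simp [List.replicate_succ']
    rw [List.take_succ_cons, List.drop_succ_cons, List.reverse_cons, List.append_assoc,
      List.singleton_append]
    conv in List.replicate (c + 1) true ++ σ.colT => rw [e1]
    exact h.mono (by omega)

theorem reverse_unary_append (c : ℕ) (l : List Bool) :
    (unary c).reverse ++ l = false :: (List.replicate c true ++ l) := by
  simp [unary]

theorem unary_append (c : ℕ) (l : List Bool) :
    unary c ++ l = List.replicate c true ++ false :: l := by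
  simp [unary]

theorem runR_mark_loop (S : List Bool) (cs : List ℕ) : ∀ σ : Regs, (∀ c ∈ cs, c < S.length) →
    RunR O Q (.loop 3 Option.isSome (.seq seekProg (.seq (.pop 3) (.seq (.push 4 false)
      (.seq (bitProg 1 fun b => .push 6 b) (moveProg 2 1))))))
      { σ with col := cs.flatMap unary, sub := S, subT := [] }
      { σ with
        col := []
        colT := (cs.flatMap unary).reverse ++ σ.colT
        pastT := (cs.map fun c => S.getD c false).reverse ++ σ.pastT
        sub := S
        subT := [] } (cs.length * (10 * S.length + 7) + 1) := by
  induction cs with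
  | nil => exact fun σ _ => (Run.loop_done rfl : Run O Q _ _ _ 1).mono (by omega)
  | cons c cs ih =>
    intro σ hcs
    have hc : c < S.length := hcs c List.mem_cons_self
    have h1 := runR_seek (O := O) (Q := Q) c (cs.flatMap unary) S { σ with subT := [] } hc.le
    have hb : ((S.drop c).head?.getD false) = S.getD c false := by
      rw [List.head?_drop, List.getD_eq_getElem?_getD]
    have h5 := RunR.move (O := O) (Q := Q) 2 1
      { σ with
        col := cs.flatMap unary
        colT := (unary c).reverse ++ σ.colT
        pastT := S.getD c false :: σ.pastT
        sub := S.drop c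
        subT := (S.take c).reverse ++ [] } ((S.take c).reverse ++ []) rfl
    have e5 : ((S.take c).reverse ++ ([] : List Bool)).reverse ++ S.drop c = S := by simp
    simp only [Regs.set, Regs.store, e5] at h5
    simp only [reverse_unary_append] at h5
    have hbody := Run.seq h1 (Run.seq (RunR.pop _ 3) (Run.seq (RunR.push _ 4 false)
      (Run.seq (RunR.bit (i := 1) (p := fun b => .push 6 b) _ hb (RunR.push _ 6 _)) h5)))
    rw [← unary_append] at hbody
    have h := Run.loop_step (c := Option.isSome) (i := 3) (by cases c <;> rfl) hbody
      (ih { σ with colT := false :: (List.replicate c true ++ σ.colT),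
                   pastT := S.getD c false :: σ.pastT }
        fun c' h' => hcs c' (List.mem_cons_of_mem _ h'))
    simp only [List.flatMap_cons, List.reverse_append, List.append_assoc, List.map_cons,
      List.reverse_cons, List.singleton_append, reverse_unary_append]
    refine h.mono ?_
    simp only [List.length_append, List.length_reverse, List.length_take, List.length_nil,
      List.length_cons]
    have : min c S.length ≤ S.length := min_le_right _ _
    nlinarith

theorem length_unary (c : ℕ) : (unary c).length = c + 1 := by simp [unary]

theorem length_flatMap_unary_le (cs : List ℕ) (k : ℕ) (h : ∀ c ∈ cs, c < k) :
    (cs.flatMap unary).length ≤ cs.length * k := by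
  induction cs with
  | nil => simp
  | cons c cs ih =>
    have h1 := ih fun c' h' => h c' (List.mem_cons_of_mem _ h')
    have h2 := h c List.mem_cons_self
    rw [List.flatMap_cons, List.length_append, length_unary, List.length_cons, Nat.succ_mul]
    omega

theorem runR_mark (S : List Bool) (cs : List ℕ) (σ : Regs) (hcs : ∀ c ∈ cs, c < S.length) :
    RunR O Q markProg
      { σ with col := cs.flatMap unary, colT := [], pastT := [], fut := [], sub := S, subT := [] }
      { σ with
        col := cs.flatMap unary
        colT := []
        pastT := []
        fut := cs.map fun c => S.getD c false
        sub := S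
        subT := [] } (cs.length * (14 * S.length + 11) + 3) := by
  have h1 := runR_mark_loop (O := O) (Q := Q) S cs
    { σ with colT := [], pastT := [], fut := [] } hcs
  have h2 := RunR.move (O := O) (Q := Q) 4 3
      { σ with
        col := []
        colT := (cs.flatMap unary).reverse ++ []
        pastT := (cs.map fun c => S.getD c false).reverse ++ []
        fut := []
        sub := S
        subT := [] } _ rfl
  have h3 := RunR.move (O := O) (Q := Q) 6 7
      { σ with
        col := cs.flatMap unary
        colT := []
        pastT := (cs.map fun c => S.getD c false).reverse ++ []
        fut := []
        sub := S
        subT := [] } _ rfl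
  simp only [Regs.set, Regs.store, List.append_nil, List.reverse_reverse, List.length_reverse,
    List.length_map] at h1 h2 h3
  have hl := length_flatMap_unary_le cs S.length hcs
  exact (Run.seq h1 (Run.seq h2 h3)).mono (by nlinarith)

theorem runR_sign (S : List Bool) : ∀ (f : Bool) (σ : Regs),
    RunR O Q signProg { σ with sub := S, sgn := [f] }
      { σ with
        sub := []
        subT := S.reverse ++ σ.subT
        qry := List.replicate S.length true ++ σ.qry
        sgn := [absentParity f S] } (8 * S.length + 1) := by
  induction S with
  | nil => exact fun f σ => Run.loop_done rfl
  | cons b S ih =>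
    intro f σ
    have hflip : RunR O Q (if b then .skip else takeProg 13 fun f => .push 13 !f)
        { σ with sub := S, subT := b :: σ.subT, qry := true :: σ.qry, sgn := [f] }
        { σ with sub := S, subT := b :: σ.subT, qry := true :: σ.qry, sgn := [f ^^ !b] } 3 := by
      cases b with
      | true =>
        simp only [if_true, Bool.not_true, Bool.xor_false]
        exact (Run.skip _).mono (by omega)
      | false =>
        simp only [Bool.not_false, Bool.xor_true]
        exact RunR.take (p := fun f => .push 13 !f) f rfl (RunR.push _ 13 _)
    have hbody := RunR.take (O := O) (Q := Q) (i := 1) (σ := { σ with sub := b :: S, sgn := [f] })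
      (p := fun b => .seq (.push 2 b) (.seq (.push 12 true)
        (if b then .skip else takeProg 13 fun f => .push 13 !f))) b rfl
      (Run.seq (RunR.push _ 2 b) (Run.seq (RunR.push _ 12 true) hflip))
    have h := Run.loop_step (c := Option.isSome) (i := 1) rfl hbody
      (ih (f ^^ !b) { σ with subT := b :: σ.subT, qry := true :: σ.qry })
    have e : List.replicate (b :: S).length true ++ σ.qry =
        List.replicate S.length true ++ true :: σ.qry := by
      simp [List.replicate_succ']
    rw [e, List.reverse_cons, List.append_assoc, List.singleton_append, absentParity]
    exact h.mono (by simp; omega)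

/-- The carry is kept on stack 6, which holds at most one bit; the empty stack at the start reads as
carry 0. The final carry is discarded, as befits arithmetic modulo a power of two. -/
theorem runR_ripple_loop (f : Bool) (acc : List Bool) : ∀ (c : Bool) (t x : List Bool) (σ : Regs),
    t.head?.getD false = c → t.length ≤ 1 → x.length ≤ acc.length →
    ∃ t', t'.length ≤ 1 ∧
    RunR O Q (.loop 14 Option.isSome (takeProg 14 fun a => takeProg 12 fun b => takeProg 6 fun c =>
      bitProg 13 fun f => .seq (.push 10 (a ^^ b ^^ c)) (.push 6 (majority (a ^^ f) b c))))
      { σ with acc := acc, pastT := t, qry := x, sgn := [f] }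
      { σ with
        acc := []
        pastT := t'
        qry := []
        sgn := [f]
        res := (ripple f c acc x).reverse ++ σ.res } (10 * acc.length + 1) := by
  induction acc with
  | nil =>
    intro c t x σ _ ht hx
    obtain rfl : x = [] := by simpa using hx
    exact ⟨t, ht, Run.loop_done rfl⟩
  | cons a acc ih =>
    intro c t x σ hc ht hx
    obtain ⟨b, hb⟩ : ∃ b, x.head?.getD false = b := ⟨_, rfl⟩
    have htail : t.tail = [] := by
      rw [← List.length_eq_zero_iff, List.length_tail]; omega
    have hpush := RunR.push (O := O) (Q := Q)
      { σ with acc := acc, pastT := t.tail, qry := x.tail, sgn := [f],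
               res := (a ^^ b ^^ c) :: σ.res } 6 (majority (a ^^ f) b c)
    have hbody := RunR.take (O := O) (Q := Q) (i := 14)
      (σ := { σ with acc := a :: acc, pastT := t, qry := x, sgn := [f] })
      (p := fun a => takeProg 12 fun b => takeProg 6 fun c =>
        bitProg 13 fun f => .seq (.push 10 (a ^^ b ^^ c)) (.push 6 (majority (a ^^ f) b c))) a rfl
      (RunR.take b hb (RunR.take c hc (RunR.bit f rfl (Run.seq (RunR.push _ 10 _) hpush))))
    obtain ⟨t', ht', hrun⟩ := ih (majority (a ^^ f) b c) (majority (a ^^ f) b c :: t.tail) x.tail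
      { σ with res := (a ^^ b ^^ c) :: σ.res } rfl (by simp [htail])
      (by simp only [List.length_tail, List.length_cons] at hx ⊢; omega)
    refine ⟨t', ht', ?_⟩
    have h := Run.loop_step (c := Option.isSome) (i := 14) rfl hbody hrun
    rw [ripple, List.reverse_cons, List.append_assoc, List.singleton_append, hb]
    exact h.mono (by simp; omega)

theorem runR_ripple (f : Bool) (acc x : List Bool) (σ : Regs) (hx : x.length ≤ acc.length) :
    RunR O Q rippleProg { σ with acc := acc, pastT := [], qry := x, sgn := [f], res := [] }
      { σ with acc := ripple f false acc x, pastT := [], qry := [], sgn := [], res := [] }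
      (14 * acc.length + 4) := by
  obtain ⟨t, ht, h⟩ := runR_ripple_loop (O := O) (Q := Q) f acc false [] x { σ with res := [] }
    rfl (by simp) hx
  have h2 := Run.seq (RunR.pop (O := O) (Q := Q)
    { σ with acc := [], pastT := t, qry := [], sgn := [f],
             res := (ripple f false acc x).reverse ++ [] } 6)
    (Run.seq (RunR.pop _ 13) (RunR.move 10 14 _ _ rfl))
  have htail : t.tail = [] := by
    rw [← List.length_eq_zero_iff, List.length_tail]; omega
  simp only [Regs.set, Regs.store, List.append_nil, List.reverse_reverse, List.length_reverse,
    length_ripple, htail, List.tail_cons] at h h2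
  exact (Run.seq h h2).mono (by omega)

theorem runR_next_loop (m : ℕ) (r : List Bool) (hr : r.head? ≠ some true) : ∀ σ : Regs,
    RunR O Q (.loop 1 (fun o => o == some true) (.seq (.pop 1) (.push 2 false)))
      { σ with sub := List.replicate m true ++ r }
      { σ with sub := r, subT := List.replicate m false ++ σ.subT } (3 * m + 1) := by
  induction m with
  | zero => exact fun σ => Run.loop_done (by simpa [Regs.store] using hr)
  | succ m ih =>
    intro σ
    have h := Run.loop_step (c := fun o => o == some true) (i := 1) rfl
      (Run.seq (RunR.pop (O := O) (Q := Q) { σ with sub := List.replicate (m + 1) true ++ r } 1)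
        (RunR.push _ 2 false)) (ih { σ with subT := false :: σ.subT })
    have e : List.replicate (m + 1) false ++ σ.subT = List.replicate m false ++ false :: σ.subT := by
      simp [List.replicate_succ']
    conv in List.replicate (m + 1) false ++ σ.subT => rw [e]
    exact h.mono (by omega)

theorem runR_next_of_lt {k i : ℕ} (σ : Regs) (h : i + 1 < 2 ^ k) :
    RunR O Q nextProg { σ with sub := lowBits k i, subT := [] }
      { σ with sub := lowBits k (i + 1), subT := [] } (7 * k + 5) := by
  obtain ⟨m, r, h1, h2⟩ := lowBits_succ h
  have hm : m ≤ k := by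
    have := congrArg List.length h1
    simp [length_lowBits] at this
    omega
  rw [h1, h2]
  have h3 := runR_next_loop (O := O) (Q := Q) m (false :: r) (by simp) { σ with subT := [] }
  have h4 := Run.ite_true (i := 1) (c := Option.isSome) (q := .pop 16) rfl
    (Run.seq (RunR.pop (O := O) (Q := Q)
      { σ with sub := false :: r, subT := List.replicate m false ++ [] } 1) (RunR.push _ 1 true))
  have h5 := Run.seq h3 (Run.seq h4 (RunR.move 2 1 _ _ rfl))
  simp only [Regs.set, Regs.store, List.append_nil, List.reverse_replicate, List.length_replicate,
    List.tail_cons] at h5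
  exact h5.mono (by omega)

/-- After the full set the carry runs off the word, and the guard on stack 16 is removed. The word
left on stack 1 is never used, so it stays unspecified. -/
theorem runR_next_of_eq {k i : ℕ} (σ : Regs) (h : i + 1 = 2 ^ k) : ∃ S,
    RunR O Q nextProg { σ with sub := lowBits k i, subT := [], go := [true] }
      { σ with sub := S, subT := [], go := [] } (7 * k + 5) := by
  rw [lowBits_last h]
  have h3 := runR_next_loop (O := O) (Q := Q) k [] (by simp) { σ with subT := [], go := [true] }
  have h4 := Run.ite_false (i := 1) (c := Option.isSome) (p := .seq (.pop 1) (.push 1 true)) rfl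
    (RunR.pop (O := O) (Q := Q)
      { σ with sub := [], subT := List.replicate k false ++ [], go := [true] } 16)
  have h5 := Run.seq h3 (Run.seq h4 (RunR.move 2 1 _ _ rfl))
  simp only [Regs.set, Regs.store, List.append_nil, List.reverse_replicate, List.length_replicate,
    List.tail_cons] at h5
  exact ⟨_, h5.mono (by omega)⟩

end Programs

/-! ## The signed sum over the sets of colours -/

/-- The registers between two rounds of `sumProg`. -/
noncomputable def sumRegs (x : ColouredInstance) (S A go : List Bool) : Regs where
  inp := []
  sub := S
  subT := []
  col := colourBits x.colour
  colT := []
  past := []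
  pastT := []
  fut := []
  gr := graphBits x.graph
  grT := []
  res := []
  cnt := []
  qry := []
  sgn := []
  acc := A
  err := []
  go := go

/-- Clears stack `14` to as many zeros as there are entries of the matrix on stack `8`, plus one. -/
def zeroProg : Prog :=
  .seq (.loop 8 Option.isSome (takeProg 8 fun b => .seq (.push 9 b) (.push 14 false)))
    (.seq (.push 14 false) (.seq (moveProg 9 8) (.push 16 true)))

/-- Moves the number on stack `14` to stack `0`, without leading zeros. -/
def stripProg : Prog :=
  .seq (moveProg 14 10) (.seq (.loop 10 (fun o => o == some false) (.pop 10)) (moveProg 10 0))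

theorem colourBits_eq {n k : ℕ} (f : Fin n → Fin k) :
    colourBits f = ((List.finRange n).map fun v => (f v).val).flatMap unary := by
  rw [colourBits, List.flatMap_map]

namespace ColouredInstance

variable (x : ColouredInstance)

theorem length_encode : x.encode.length =
    (x.k + 1) + ((x.n + 1) + ((colourBits x.colour).length + (graphBits x.graph).length)) := by
  simp only [encode, List.length_append, length_unary]

theorem restrict_n_le (S : List Bool) : (x.restrict S).n ≤ x.n :=
  (List.length_filter_le _ _).trans (by simp)

theorem length_graphBits_restrict_le (S : List Bool) :
    (graphBits (x.restrict S).graph).length ≤ x.n * x.n := by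
  rw [length_graphBits]
  have h := x.restrict_n_le S
  exact (rowsLength_le 0 _).trans (by rw [zero_add]; exact Nat.mul_le_mul h h)

end ColouredInstance

section Programs

variable {O : List Bool → ℕ} {Q : List Bool → Prop}

/-- The matrix of a graph has exactly the length that the program reads, so there is no error and no
remainder. -/
theorem runR_filter_graphBits {n : ℕ} (G : SimpleGraph (Fin n)) (m : Fin n → Bool) (σ : Regs) :
    RunR O Q filterProg
      { σ with past := [], pastT := [], fut := (List.finRange n).map m, gr := graphBits G,
               grT := [], res := [], cnt := [], err := [] }
      { σ with
        past := (List.finRange n).map m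
        pastT := []
        fut := []
        gr := []
        grT := (graphBits G).reverse
        res := (selectRows [] ((List.finRange n).map m) (graphBits G)).reverse
        cnt := List.replicate ((List.finRange n).filter m).length true
        err := [] } (n * (14 * n + 12) + 1) := by
  obtain ⟨g, r, e, hg, hrun, h1, h2⟩ := runR_filter (O := O) (Q := Q) ((List.finRange n).map m) []
    { σ with gr := graphBits G, grT := [], res := [], cnt := [], err := [] }
  simp only [List.length_map, List.length_finRange, List.length_nil] at hg h1 h2
  rw [length_graphBits] at h2
  obtain rfl : e = [] := by
    by_contra h
    exact absurd (h2 h) (lt_irrefl _)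
  have h3 := h1 rfl
  have h4 := congrArg List.length h3
  rw [length_graphBits, List.length_append, hg] at h4
  obtain rfl : r = [] := List.length_eq_zero_iff.mp (by omega)
  rw [List.append_nil] at h3
  subst h3
  have hc : ((List.finRange n).map m).count true = ((List.finRange n).filter m).length := by
    rw [List.count_eq_countP, List.countP_map, List.countP_eq_length_filter]
    congr 2
    funext v
    simp
  simp only [List.append_nil, List.nil_append, hc, List.length_map, List.length_finRange,
    List.length_nil, zero_add] at hrun
  exact hrun

open Classical in
-- The query is written onto a stack, hence back to front: the submatrix, then the number of kept
-- vertices, then `k`. All other registers are restored for the next round.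
theorem runR_build (x : ColouredInstance) (S A go : List Bool) (hS : S.length = x.k) :
    RunR O Q buildProg (sumRegs x S A go)
      { sumRegs x S A go with qry := (x.restrict S).encode, sgn := [absentParity false S] }
      (100 * (x.n + x.k + (graphBits x.graph).length + 1) ^ 2) := by
  have h1 := runR_mark (O := O) (Q := Q) S ((List.finRange x.n).map fun v => (x.colour v).val)
    (sumRegs x S A go) (by simp [hS])
  rw [← colourBits_eq, List.map_map] at h1
  change RunR O Q markProg (sumRegs x S A go)
    { sumRegs x S A go with fut := (List.finRange x.n).map (hasColourIn x.colour S) } _ at h1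
  have h2 := runR_filter_graphBits (O := O) (Q := Q) x.graph (hasColourIn x.colour S)
    (sumRegs x S A go)
  have hsel : selectRows [] ((List.finRange x.n).map (hasColourIn x.colour S))
      (graphBits x.graph) = graphBits (x.restrict S).graph := by
    have h3 := x.encode_restrict S
    rw [UncolouredInstance.encode] at h3
    have h4 := selectRows_rows (hasColourIn x.colour S) (fun u v => decide (x.graph.Adj u v)) []
      (List.finRange x.n)
    rw [List.map_nil, ← graphBits_eq_rows] at h4
    rw [h4]
    exact (List.append_cancel_left (List.append_cancel_left h3)).symm
  rw [hsel] at h2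
  have h3 := RunR.clear (O := O) (Q := Q) 5
    { sumRegs x S A go with
      past := (List.finRange x.n).map (hasColourIn x.colour S)
      gr := []
      grT := (graphBits x.graph).reverse
      res := (graphBits (x.restrict S).graph).reverse
      cnt := List.replicate (x.restrict S).n true } _ rfl
  have h4 := RunR.move (O := O) (Q := Q) 9 8
    { sumRegs x S A go with
      gr := []
      grT := (graphBits x.graph).reverse
      res := (graphBits (x.restrict S).graph).reverse
      cnt := List.replicate (x.restrict S).n true } _ rfl
  have h5 := RunR.move (O := O) (Q := Q) 10 12
    { sumRegs x S A go with
      gr := (graphBits x.graph).reverse.reverse ++ []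
      res := (graphBits (x.restrict S).graph).reverse
      cnt := List.replicate (x.restrict S).n true } _ rfl
  have h6 := RunR.move (O := O) (Q := Q) 11 12
    { sumRegs x S A go with
      gr := (graphBits x.graph).reverse.reverse ++ []
      qry := false :: ((graphBits (x.restrict S).graph).reverse.reverse ++ [])
      cnt := List.replicate (x.restrict S).n true } _ rfl
  have h7 := runR_sign (O := O) (Q := Q) S false
    { sumRegs x S A go with
      gr := (graphBits x.graph).reverse.reverse ++ []
      qry := false :: ((List.replicate (x.restrict S).n true).reverse ++
        false :: ((graphBits (x.restrict S).graph).reverse.reverse ++ [])) }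
  have h8 := RunR.move (O := O) (Q := Q) 2 1
    { sumRegs x S A go with
      sub := []
      subT := S.reverse ++ []
      gr := (graphBits x.graph).reverse.reverse ++ []
      qry := List.replicate S.length true ++
        false :: ((List.replicate (x.restrict S).n true).reverse ++
        false :: ((graphBits (x.restrict S).graph).reverse.reverse ++ []))
      sgn := [absentParity false S] } _ rfl
  have h := Run.seq h1 (Run.seq h2 (Run.seq h3 (Run.seq h4 (Run.seq h5 (Run.seq
    (RunR.push _ 12 false) (Run.seq h6 (Run.seq (RunR.push _ 12 false) (Run.seq
    (RunR.push _ 13 false) (Run.seq h7 h8)))))))))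
  have hq : (x.restrict S).encode = List.replicate S.length true ++
      false :: ((List.replicate (x.restrict S).n true).reverse ++
        false :: ((graphBits (x.restrict S).graph).reverse.reverse ++ [])) := by
    rw [UncolouredInstance.encode, unary_append, unary_append, hS]
    simp [ColouredInstance.restrict]
  rw [← hq] at h
  simp only [Regs.set, Regs.store, List.append_nil, List.reverse_reverse] at h
  refine Run.mono h ?_
  have b1 := x.restrict_n_le S
  have b2 := x.length_graphBits_restrict_le S
  simp only [List.length_map, List.length_finRange, List.length_reverse, List.length_replicate, hS]
  nlinarith [Nat.zero_le (x.n * x.k), Nat.zero_le (x.n * (graphBits x.graph).length),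
    Nat.zero_le (x.k * (graphBits x.graph).length), Nat.zero_le (x.k * x.k),
    Nat.zero_le ((graphBits x.graph).length * (graphBits x.graph).length)]

theorem runR_zero (x : ColouredInstance) (S : List Bool) :
    RunR O Q zeroProg (sumRegs x S [] [])
      (sumRegs x S (List.replicate ((graphBits x.graph).length + 1) false) [true])
      (10 * (graphBits x.graph).length + 5) := by
  have key : ∀ (g : List Bool) (σ : Regs),
      RunR O Q (.loop 8 Option.isSome (takeProg 8 fun b => .seq (.push 9 b) (.push 14 false)))
        { σ with gr := g }
        { σ with
          gr := []
          grT := g.reverse ++ σ.grT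
          acc := List.replicate g.length false ++ σ.acc } (5 * g.length + 1) := by
    intro g
    induction g with
    | nil => exact fun σ => Run.loop_done rfl
    | cons b g ih =>
      intro σ
      have hbody := RunR.take (O := O) (Q := Q) (i := 8) (σ := { σ with gr := b :: g })
        (p := fun b => .seq (.push 9 b) (.push 14 false)) b rfl
        (Run.seq (RunR.push _ 9 b) (RunR.push _ 14 false))
      have h := Run.loop_step (c := Option.isSome) (i := 8) rfl hbody
        (ih { σ with grT := b :: σ.grT, acc := false :: σ.acc })
      have e : List.replicate (b :: g).length false ++ σ.acc =
          List.replicate g.length false ++ false :: σ.acc := by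
        simp [List.replicate_succ']
      rw [e, List.reverse_cons, List.append_assoc, List.singleton_append]
      exact h.mono (by simp; omega)
  have h := Run.seq (key (graphBits x.graph) (sumRegs x S [] []))
    (Run.seq (RunR.push _ 14 false) (Run.seq (RunR.move 9 8 _ _ rfl) (RunR.push _ 16 true)))
  simp only [Regs.set, Regs.store, sumRegs, List.append_nil, List.reverse_reverse,
    ← List.replicate_succ] at h
  refine Run.mono h ?_
  simp only [List.length_reverse]
  omega

/-- The first move puts the most significant digit on top, where leading zeros can be popped; the
second restores the order. -/
theorem runR_strip (σ : Regs) (A : List Bool) :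
    RunR O Q stripProg { σ with acc := A, res := [], inp := [] }
      { σ with acc := [], res := [], inp := Nat.bits (bitsValue A) } (10 * A.length + 3) := by
  have key : ∀ (l : List Bool) (τ : Regs), ∃ l' m, l = List.replicate m false ++ l' ∧
      l'.head? ≠ some false ∧
      RunR O Q (.loop 10 (fun o => o == some false) (.pop 10)) { τ with res := l }
        { τ with res := l' } (2 * l.length + 1) := by
    intro l
    induction l with
    | nil => exact fun τ => ⟨[], 0, rfl, by simp, Run.loop_done rfl⟩
    | cons b l ih =>
      intro τ
      cases b with
      | true => exact ⟨true :: l, 0, rfl, by simp,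
          (Run.loop_done rfl : Run O Q _ _ _ 1).mono (by omega)⟩
      | false =>
        obtain ⟨l', m, h1, h2, h3⟩ := ih τ
        refine ⟨l', m + 1, by rw [h1]; rfl, h2, ?_⟩
        exact (Run.loop_step (c := fun o => o == some false) (i := 10) rfl
          (RunR.pop (O := O) (Q := Q) { τ with res := false :: l } 10) h3).mono
          (by simp; omega)
  obtain ⟨l', m, h1, h2, h3⟩ := key (A.reverse ++ []) { σ with acc := [], inp := [] }
  have h4 := Run.seq (RunR.move (O := O) (Q := Q) 14 10
    { σ with acc := A, res := [], inp := [] } _ rfl)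
    (Run.seq h3 (RunR.move 10 0 _ _ rfl))
  rw [List.append_nil] at h1
  have h5 : A = l'.reverse ++ List.replicate m false := by
    rw [← List.reverse_inj, h1]; simp
  have h6 : l'.reverse = Nat.bits (bitsValue A) := by
    rw [h5, bitsValue_append_replicate_false]
    exact eq_bits_of_getLast _ (by simpa using h2)
  simp only [Regs.set, Regs.store, List.append_nil, h6] at h4
  refine Run.mono h4 ?_
  have := congrArg List.length h1
  simp only [List.length_reverse, List.length_append, List.length_replicate] at this ⊢
  omega

end Programs

/-- The parameter is at most `k`. -/
def ParamLe (k : ℕ) (q : List Bool) : Prop := leadingOnes q ≤ k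

namespace ColouredInstance

variable (x : ColouredInstance)

/-- A measure of the size of an instance. -/
noncomputable def size : ℕ := x.n + x.k + (graphBits x.graph).length + 1

theorem size_le_length_encode : x.size ≤ x.encode.length := by
  rw [x.length_encode, size]; omega

end ColouredInstance

section Sum

variable (Φ : PropertyFamily) (x : ColouredInstance)

/-- Adds the term of the set of colours `S`. -/
noncomputable def addTerm (S A : List Bool) : List Bool :=
  ripple (absentParity false S) false A (Nat.bits (strEmb (Φ.graphs x.k) (x.restrict S).graph))

/-- The effect of `nextProg` is a hypothesis, so that the lemma covers both the last round and all
earlier ones. -/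
theorem runR_term (S A go : List Bool) (hS : S.length = x.k)
    (hA : A.length = (graphBits x.graph).length + 1) {S' go' : List Bool} {T : ℕ}
    (hnext : RunR (inducedSubgraphWithProperty Φ).count (ParamLe x.k) nextProg
      (sumRegs x S (addTerm Φ x S A) go) (sumRegs x S' (addTerm Φ x S A) go') T) :
    RunR (inducedSubgraphWithProperty Φ).count (ParamLe x.k)
      (.seq buildProg (.seq (.query 12) (.seq rippleProg nextProg)))
      (sumRegs x S A go) (sumRegs x S' (addTerm Φ x S A) go') (130 * x.size ^ 2 + T) := by
  obtain ⟨hcount, hparam⟩ := inducedSubgraphWithProperty_encode Φ (x.restrict S)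
  have h1 := runR_build (O := (inducedSubgraphWithProperty Φ).count) (Q := ParamLe x.k) x S A go hS
  have h2 := RunR.query (O := (inducedSubgraphWithProperty Φ).count) (Q := ParamLe x.k)
    { sumRegs x S A go with qry := (x.restrict S).encode, sgn := [absentParity false S] } 12
    (le_of_eq hparam)
  simp only [Regs.set, Regs.store, hcount] at h2
  have h3 := runR_ripple (O := (inducedSubgraphWithProperty Φ).count) (Q := ParamLe x.k)
    (absentParity false S) A (Nat.bits (strEmb (Φ.graphs x.k) (x.restrict S).graph))
    (sumRegs x S A go) (by rw [hA]; exact length_bits_strEmb_le x S _)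
  have h := Run.seq h1 (Run.seq h2 (Run.seq h3 hnext))
  -- Building the query accounts for 100 of the 130; the rest pays for asking it and for the
  -- addition.
  refine Run.mono h ?_
  have b1 := x.restrict_n_le S
  have b2 := x.length_graphBits_restrict_le S
  have b3 : (x.restrict S).encode.length =
      (x.k + 1) + (((x.restrict S).n + 1) + (graphBits (x.restrict S).graph).length) := by
    simp only [UncolouredInstance.encode, List.length_append, length_unary]; rfl
  rw [hA, b3, ← ColouredInstance.size]
  have b4 : x.n ≤ x.size := by rw [ColouredInstance.size]; omega
  have b5 : x.n + x.k + (graphBits x.graph).length + 1 = x.size := rfl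
  have b6 := Nat.mul_le_mul b4 b4
  nlinarith

theorem length_addTerm (S A : List Bool) : (addTerm Φ x S A).length = A.length :=
  length_ripple _ _ _ _

theorem bitsValue_addTerm (S A : List Bool) : ∃ d : ℤ, (bitsValue (addTerm Φ x S A) : ℤ) =
    bitsValue A + absentSign S * (strEmb (Φ.graphs x.k) (x.restrict S).graph : ℕ) +
      2 ^ A.length * d := by
  obtain ⟨d, hd⟩ := bitsValue_ripple (absentParity false S) false A
    (Nat.bits (strEmb (Φ.graphs x.k) (x.restrict S).graph))
  refine ⟨d, ?_⟩
  rw [addTerm, hd, bitsValue_bits, absentSign]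
  simp

/-- Induction on the rounds still to come, `d + 1` in number, so that the base case is the round in
which the counter overflows. -/
theorem runR_sum (d : ℕ) : ∀ (i : ℕ) (A : List Bool), i + (d + 1) = 2 ^ x.k →
    A.length = (graphBits x.graph).length + 1 → ∃ S' A',
    A'.length = A.length ∧
    (∃ e : ℤ, (bitsValue A' : ℤ) = bitsValue A + ∑ j ∈ Finset.Ico i (2 ^ x.k),
      absentSign (lowBits x.k j) *
        (strEmb (Φ.graphs x.k) (x.restrict (lowBits x.k j)).graph : ℕ) + 2 ^ A.length * e) ∧
    RunR (inducedSubgraphWithProperty Φ).count (ParamLe x.k) sumProg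
      (sumRegs x (lowBits x.k i) A [true]) (sumRegs x S' A' [])
      ((d + 1) * (143 * x.size ^ 2) + 1) := by
  -- The counter step and the loop test of one round; with the 130 of `runR_term` this makes 143.
  have hsize : 7 * x.k + 6 ≤ 13 * x.size ^ 2 := by
    have : x.k + 1 ≤ x.size := by rw [ColouredInstance.size]; omega
    nlinarith
  induction d with
  | zero =>
    intro i A hi hA
    obtain ⟨S', hnext⟩ := runR_next_of_eq (O := (inducedSubgraphWithProperty Φ).count)
      (Q := ParamLe x.k) (sumRegs x (lowBits x.k i) (addTerm Φ x (lowBits x.k i) A) [true]) hi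
    have h1 := runR_term Φ x (lowBits x.k i) A [true] (length_lowBits _ _) hA
      (S' := S') (go' := []) hnext
    refine ⟨S', _, length_addTerm Φ x _ _, ?_, (Run.loop_step rfl h1 (Run.loop_done rfl)).mono ?_⟩
    · obtain ⟨e, he⟩ := bitsValue_addTerm Φ x (lowBits x.k i) A
      refine ⟨e, ?_⟩
      rw [he, ← hi, Nat.Ico_succ_singleton, Finset.sum_singleton]
    · omega
  | succ d ih =>
    intro i A hi hA
    have hnext := runR_next_of_lt (O := (inducedSubgraphWithProperty Φ).count)
      (Q := ParamLe x.k) (sumRegs x (lowBits x.k i) (addTerm Φ x (lowBits x.k i) A) [true])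
      (show i + 1 < 2 ^ x.k by omega)
    have h1 := runR_term Φ x (lowBits x.k i) A [true] (length_lowBits _ _) hA
      (S' := lowBits x.k (i + 1)) (go' := [true]) hnext
    obtain ⟨S', A', hA', ⟨e', he'⟩, h2⟩ := ih (i + 1) (addTerm Φ x (lowBits x.k i) A) (by omega)
      (by rw [length_addTerm, hA])
    rw [length_addTerm] at hA' he'
    refine ⟨S', A', hA', ?_, (Run.loop_step rfl h1 h2).mono ?_⟩
    · obtain ⟨e, he⟩ := bitsValue_addTerm Φ x (lowBits x.k i) A
      refine ⟨e + e', ?_⟩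
      rw [he', he, Finset.sum_eq_sum_Ico_succ_bot (show i < 2 ^ x.k by omega)]
      ring
    · rw [Nat.succ_mul (d + 1)]; omega

/-- Computes the answer for the instance on the stacks `1`, `3`, `8`. -/
def countColourfulProg : Prog := .seq zeroProg (.seq sumProg stripProg)

theorem runR_countColourful : ∃ τ : Regs,
    τ.inp = Nat.bits (colStrEmb (Φ.graphs x.k) x.graph x.colour) ∧
    RunR (inducedSubgraphWithProperty Φ).count (ParamLe x.k) countColourfulProg
      (sumRegs x (List.replicate x.k false) [] []) τ (2 ^ x.k * (163 * x.size ^ 2) + 19) := by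
  have hpos : 0 < 2 ^ x.k := by positivity
  obtain ⟨S', A', hA', ⟨e, he⟩, h2⟩ := runR_sum Φ x (2 ^ x.k - 1) 0
    (List.replicate ((graphBits x.graph).length + 1) false) (by omega) (by simp)
  -- The enumeration starts with the empty set of colours.
  rw [lowBits_zero] at h2
  have h1 := runR_zero (O := (inducedSubgraphWithProperty Φ).count) (Q := ParamLe x.k) x
    (List.replicate x.k false)
  have h3 := runR_strip (O := (inducedSubgraphWithProperty Φ).count) (Q := ParamLe x.k)
    (sumRegs x S' A' []) A'
  rw [List.length_replicate] at hA'
  have hval : bitsValue A' = colStrEmb (Φ.graphs x.k) x.graph x.colour := by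
    have h0 := bitsValue_append_replicate_false [] ((graphBits x.graph).length + 1)
    rw [List.nil_append, bitsValue] at h0
    rw [h0, List.length_replicate, ← Finset.range_eq_Ico, ← colStrEmb_eq_sum] at he
    have hlt := bitsValue_lt A'
    rw [hA'] at hlt
    have hlt' := colStrEmb_lt (Φ.graphs x.k) x.graph x.colour
    -- The accumulator and the answer agree modulo a power of two that exceeds both.
    have hmod : ((bitsValue A' : ℕ) : ℤ) ≡ (colStrEmb (Φ.graphs x.k) x.graph x.colour : ℕ)
        [ZMOD ((2 ^ ((graphBits x.graph).length + 1) : ℕ) : ℤ)] := by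
      refine (Int.modEq_iff_dvd.mpr ⟨-e, ?_⟩)
      rw [he]; push_cast; ring
    exact Nat.ModEq.eq_of_lt_of_lt (Int.natCast_modEq_iff.mp hmod) hlt hlt'
  rw [hval] at h3
  refine ⟨_, ?_, (Run.seq h1 (Run.seq h2 h3)).mono ?_⟩
  · rfl
  · rw [hA', show 2 ^ x.k - 1 + 1 = 2 ^ x.k by omega]
    have b : (graphBits x.graph).length + 1 ≤ x.size := by rw [ColouredInstance.size]; omega
    have : (graphBits x.graph).length + 1 ≤ x.size ^ 2 := by nlinarith
    nlinarith

end Sum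

/-! ## Parsing an instance -/

/-- Reads a number in unary from stack `0`. -/
def unaryProg : Prog :=
  .seq (.loop 0 (fun o => o == some true) (.seq (.pop 0) (.seq (.push 11 true) (.push 10 false))))
    (.seq (needProg 0) (.pop 0))

/-- Reads a colour from stack `0` and compares it to the number of colours. -/
def colourProg : Prog :=
  .seq (.loop 0 (fun o => o == some true) (.seq (.pop 0) (.seq (.push 4 true)
    (.ite 1 Option.isSome (.seq (.pop 1) (.push 2 false)) (.push 15 true)))))
    (.seq (needProg 1) (.seq (needProg 0) (.seq (.pop 0) (.seq (.push 4 false) (moveProg 2 1)))))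

/-- Reads a colour for each entry of stack `7`. -/
def coloursProg : Prog :=
  .seq (.loop 7 Option.isSome (.seq (.pop 7) (.seq (.push 11 true) colourProg)))
    (.seq (moveProg 11 7) (moveProg 4 3))

/-- Reads the number of colours and the number of vertices. -/
def headerProg : Prog :=
  .seq unaryProg (.seq (clearProg 11) (.seq (moveProg 10 1) (.seq (needProg 1)
    (.seq unaryProg (.seq (clearProg 10) (moveProg 11 7))))))

/-- Reads the adjacency matrix. -/
def matrixProg : Prog :=
  .seq (moveProg 0 9) (.seq (moveProg 9 8) (.seq filterProg
    (.ite 8 Option.isSome (.push 15 true) .skip)))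

def parseProg : Prog := .seq headerProg (.seq coloursProg matrixProg)

def cleanProg : Prog :=
  .seq (clearProg 5) (.seq (clearProg 10) (.seq (clearProg 11) (moveProg 9 8)))

/-- The registers before parsing the word `w`. -/
def initRegs (w : List Bool) : Regs where
  inp := w
  sub := []
  subT := []
  col := []
  colT := []
  past := []
  pastT := []
  fut := []
  gr := []
  grT := []
  res := []
  cnt := []
  qry := []
  sgn := []
  acc := []
  err := []
  go := []

theorem init_eq_store (w : List Bool) : Store.init w = (initRegs w).store := by
  funext i
  rcases i with _ | _ | _ | _ | _ | _ | _ | _ | _ | _ | _ | _ | _ | _ | _ | _ | _ | i <;> rfl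

/-- A maximal run of ones leaves only one way to read a unary number, so a greedy parser that fails
proves that no reading exists. -/
theorem eq_unary_append_iff {m c : ℕ} {u r : List Bool} (hu : u.head? ≠ some true) :
    List.replicate m true ++ u = unary c ++ r ↔ m = c ∧ u = false :: r := by
  constructor
  · intro h
    rcases u with _ | ⟨_ | _, u⟩
    · rw [unary_append] at h
      have h1 := congrArg (fun l => false ∈ l) h
      simp at h1
    · rw [← unary_append] at h
      obtain ⟨rfl, rfl⟩ := unary_append_inj h
      exact ⟨rfl, rfl⟩
    · simp at hu
  · rintro ⟨rfl, rfl⟩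
    exact (unary_append m r).symm

section Programs

variable {O : List Bool → ℕ} {Q : List Bool → Prop}

theorem runR_unary_loop (w : List Bool) : ∀ σ : Regs, ∃ m u,
    w = List.replicate m true ++ u ∧ u.head? ≠ some true ∧
    RunR O Q (.loop 0 (fun o => o == some true)
        (.seq (.pop 0) (.seq (.push 11 true) (.push 10 false))))
      { σ with inp := w }
      { σ with inp := u, cnt := List.replicate m true ++ σ.cnt,
               res := List.replicate m false ++ σ.res } (4 * m + 1) := by
  induction w with
  | nil => exact fun σ => ⟨0, [], rfl, by simp, Run.loop_done rfl⟩
  | cons b w ih =>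
    intro σ
    cases b with
    | false => exact ⟨0, false :: w, rfl, by simp, Run.loop_done rfl⟩
    | true =>
      obtain ⟨m, u, h1, h2, h3⟩ := ih { σ with cnt := true :: σ.cnt, res := false :: σ.res }
      refine ⟨m + 1, u, by rw [h1]; rfl, h2, ?_⟩
      have h := Run.loop_step (c := fun o => o == some true) (i := 0) rfl
        (Run.seq (RunR.pop (O := O) (Q := Q) { σ with inp := true :: w } 0)
          (Run.seq (RunR.push _ 11 true) (RunR.push _ 10 false))) h3
      rw [List.replicate_succ', List.replicate_succ', List.append_assoc, List.append_assoc]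
      exact h.mono (by omega)

/-- The number is recorded twice since its two uses differ: `k` is kept as zeros, which double as
the empty set of colours, and the number of vertices as ones, which double as marks on all vertices.
-/
theorem runR_unary (w : List Bool) (σ : Regs) : ∃ m r e, m + r.length ≤ w.length ∧
    RunR O Q unaryProg { σ with inp := w, cnt := [], res := [] }
      { σ with inp := r, cnt := List.replicate m true, res := List.replicate m false,
               err := e ++ σ.err } (4 * w.length + 4) ∧
    (e = [] → w = unary m ++ r) ∧ (e ≠ [] → ∀ m' r', w ≠ unary m' ++ r') := by
  obtain ⟨m, u, h1, h2, h3⟩ := runR_unary_loop (O := O) (Q := Q) w { σ with cnt := [], res := [] }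
  obtain ⟨e, h4, h5⟩ := runR_need (O := O) (Q := Q)
    { σ with inp := u, cnt := List.replicate m true ++ [], res := List.replicate m false ++ [] } 0
  have h := Run.seq h3 (Run.seq h4 (RunR.pop _ 0))
  simp only [Regs.set, Regs.store, List.append_nil] at h h5
  have hlen : w.length = m + u.length := by rw [h1]; simp
  refine ⟨m, u.tail, e, by simp; omega, Run.mono h (by omega), ?_, ?_⟩
  · intro he
    obtain ⟨b, l, rfl⟩ := List.exists_cons_of_ne_nil (h5.mp he)
    obtain rfl : b = false := by simpa using h2
    rw [h1]; exact (unary_append m l).symm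
  · intro he m' r' hw
    rw [h1, eq_unary_append_iff h2] at hw
    exact he (h5.mpr (by simp [hw.2]))

theorem runR_colour_loop (w : List Bool) : ∀ (a b : ℕ) (σ : Regs), ∃ m u e,
    w = List.replicate m true ++ u ∧ u.head? ≠ some true ∧
    RunR O Q (.loop 0 (fun o => o == some true) (.seq (.pop 0) (.seq (.push 4 true)
        (.ite 1 Option.isSome (.seq (.pop 1) (.push 2 false)) (.push 15 true)))))
      { σ with inp := w, sub := List.replicate a false, subT := List.replicate b false }
      { σ with
        inp := u
        colT := List.replicate m true ++ σ.colT
        sub := List.replicate (a - m) false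
        subT := List.replicate (b + min m a) false
        err := e ++ σ.err } (6 * m + 1) ∧
    (e = [] ↔ m ≤ a) := by
  induction w with
  | nil =>
    exact fun a b σ => ⟨0, [], [], rfl, by simp, by
      simp only [Nat.sub_zero, Nat.zero_min, Nat.add_zero]; exact Run.loop_done rfl, by simp⟩
  | cons x w ih =>
    intro a b σ
    cases x with
    | false =>
      exact ⟨0, false :: w, [], rfl, by simp, by
        simp only [Nat.sub_zero, Nat.zero_min, Nat.add_zero]; exact Run.loop_done rfl, by simp⟩
    | true =>
      cases a with
      | zero =>
        obtain ⟨m, u, e, h1, h2, h3, h4⟩ := ih 0 b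
          { σ with colT := true :: σ.colT, err := true :: σ.err }
        refine ⟨m + 1, u, e ++ [true], by rw [h1]; rfl, h2, ?_, by simp⟩
        have h := Run.loop_step (c := fun o => o == some true) (i := 0) rfl
          (Run.seq (RunR.pop (O := O) (Q := Q) { σ with
            inp := true :: w, sub := [], subT := List.replicate b false } 0) (Run.seq (RunR.push _ 4 true)
            (Run.ite_false (i := 1) (c := Option.isSome) (p := .seq (.pop 1) (.push 2 false)) rfl
              (RunR.push _ 15 true)))) h3
        simp only [Nat.zero_sub, Nat.min_zero] at h ⊢
        rw [List.replicate_succ', List.append_assoc, List.append_assoc]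
        exact h.mono (by omega)
      | succ a =>
        obtain ⟨m, u, e, h1, h2, h3, h4⟩ := ih a (b + 1) { σ with colT := true :: σ.colT }
        refine ⟨m + 1, u, e, by rw [h1]; rfl, h2, ?_, by rw [h4]; omega⟩
        have h := Run.loop_step (c := fun o => o == some true) (i := 0) rfl
          (Run.seq (RunR.pop (O := O) (Q := Q) { σ with
            inp := true :: w, sub := List.replicate (a + 1) false,
            subT := List.replicate b false } 0)
            (Run.seq (RunR.push _ 4 true)
            (Run.ite_true (i := 1) (c := Option.isSome) (q := .push 15 true) rfl
              (Run.seq (RunR.pop _ 1) (RunR.push _ 2 false))))) h3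
        rw [show a - m = a + 1 - (m + 1) by omega,
          show b + 1 + min m a = b + min (m + 1) (a + 1) by omega] at h
        rw [List.replicate_succ' (n := m) (a := true), List.append_assoc]
        exact h.mono (by omega)

/-- The slack of 1 in the length bound arises because the closing 0 of the colour is written even if
the input lacks it. -/
theorem runR_colour (w : List Bool) (k : ℕ) (σ : Regs) : ∃ c r e,
    (unary c).length + r.length ≤ w.length + 1 ∧
    RunR O Q colourProg
      { σ with inp := w, sub := List.replicate k false, subT := [] }
      { σ with
        inp := r
        colT := (unary c).reverse ++ σ.colT
        sub := List.replicate k false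
        subT := []
        err := e ++ σ.err } (6 * w.length + 4 * k + 9) ∧
    (e = [] → w = unary c ++ r ∧ c < k) ∧
    (e ≠ [] → ∀ c' r', c' < k → w ≠ unary c' ++ r') := by
  obtain ⟨m, u, e₁, h1, h2, h3, h4⟩ := runR_colour_loop (O := O) (Q := Q) w k 0 σ
  obtain ⟨e₂, h5, h6⟩ := runR_need (O := O) (Q := Q)
    { σ with
      inp := u
      colT := List.replicate m true ++ σ.colT
      sub := List.replicate (k - m) false
      subT := List.replicate (0 + min m k) false
      err := e₁ ++ σ.err } 1
  obtain ⟨e₃, h7, h8⟩ := runR_need (O := O) (Q := Q)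
    { σ with
      inp := u
      colT := List.replicate m true ++ σ.colT
      sub := List.replicate (k - m) false
      subT := List.replicate (0 + min m k) false
      err := e₂ ++ (e₁ ++ σ.err) } 0
  have h := Run.seq h3 (Run.seq h5 (Run.seq h7 (Run.seq (RunR.pop _ 0)
    (Run.seq (RunR.push _ 4 false) (RunR.move 2 1 _ _ rfl)))))
  have e5 : (List.replicate (0 + min m k) false).reverse ++ List.replicate (k - m) false =
      List.replicate k false := by
    rw [List.reverse_replicate, List.replicate_append_replicate]
    congr 1; omega
  simp only [Regs.set, Regs.store, e5, ← reverse_unary_append] at h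
  simp only [Regs.store, ne_eq, List.replicate_eq_nil_iff] at h6 h8
  have hlen : w.length = m + u.length := by rw [h1]; simp
  refine ⟨m, u.tail, e₃ ++ (e₂ ++ e₁), by simp [length_unary]; omega, ?_, ?_, ?_⟩
  · simp only [List.append_assoc]
    refine Run.mono h ?_
    simp only [List.length_replicate]
    omega
  · intro he
    simp only [List.append_eq_nil_iff] at he
    obtain ⟨b, l, rfl⟩ := List.exists_cons_of_ne_nil (h8.mp he.1)
    obtain rfl : b = false := by simpa using h2
    -- A zero left unmatched on stack 1 gives the strict inequality between the colour and `k`.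
    have := h6.mp he.2.1
    exact ⟨by rw [h1]; exact (unary_append m l).symm, by omega⟩
  · intro he c' r' hc' hw
    rw [h1, eq_unary_append_iff h2] at hw
    apply he
    rw [h8.mpr (by simp [hw.2]), h6.mpr (by omega), h4.mpr (by omega)]
    rfl

theorem runR_colours_loop (k n : ℕ) : ∀ (w : List Bool) (σ : Regs), ∃ (cs : List ℕ) (r e : List Bool),
    cs.length = n ∧ (cs.flatMap unary).length + r.length ≤ w.length + n ∧ r.length ≤ w.length ∧
    RunR O Q (.loop 7 Option.isSome (.seq (.pop 7) (.seq (.push 11 true) colourProg)))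
      { σ with
        inp := w, sub := List.replicate k false, subT := [], fut := List.replicate n true }
      { σ with
        inp := r
        colT := (cs.flatMap unary).reverse ++ σ.colT
        sub := List.replicate k false
        subT := []
        fut := []
        cnt := List.replicate n true ++ σ.cnt
        err := e ++ σ.err } (n * (6 * w.length + 4 * k + 12) + 1) ∧
    (e = [] → w = cs.flatMap unary ++ r ∧ ∀ c ∈ cs, c < k) ∧
    (e ≠ [] → ∀ (cs' : List ℕ) r', cs'.length = n → (∀ c ∈ cs', c < k) → w ≠ cs'.flatMap unary ++ r') := by
  induction n with
  | zero =>
    exact fun w σ => ⟨[], w, [], rfl, by simp, le_rfl,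
      (Run.loop_done rfl : Run O Q _ _ _ 1).mono (by omega), by simp, by simp⟩
  | succ n ih =>
    intro w σ
    obtain ⟨c, r₁, e₁, hl₁, hrun₁, h1, h1'⟩ := runR_colour (O := O) (Q := Q) w k
      { σ with fut := List.replicate n true, cnt := true :: σ.cnt }
    obtain ⟨cs, r, e, hcs, hl, hl', hrun, h2, h2'⟩ := ih r₁
      { σ with colT := (unary c).reverse ++ σ.colT, cnt := true :: σ.cnt, err := e₁ ++ σ.err }
    have hr₁ : r₁.length ≤ w.length := by rw [length_unary] at hl₁; omega
    refine ⟨c :: cs, r, e ++ e₁, by simp [hcs], ?_, by omega, ?_, ?_, ?_⟩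
    · rw [List.flatMap_cons, List.length_append]; omega
    · have h := Run.loop_step (c := Option.isSome) (i := 7) rfl
        (Run.seq (RunR.pop (O := O) (Q := Q) { σ with
          inp := w, sub := List.replicate k false, subT := [],
          fut := List.replicate (n + 1) true } 7) (Run.seq (RunR.push _ 11 true) hrun₁)) hrun
      have e' : List.replicate (n + 1) true ++ σ.cnt = List.replicate n true ++ true :: σ.cnt := by
        simp [List.replicate_succ']
      rw [e', List.flatMap_cons, List.reverse_append, List.append_assoc, List.append_assoc]
      refine Run.mono h ?_
      nlinarith
    · intro he
      rw [List.append_eq_nil_iff] at he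
      obtain ⟨h3, h4⟩ := h1 he.2
      obtain ⟨h5, h6⟩ := h2 he.1
      refine ⟨by rw [h3, h5, List.flatMap_cons, List.append_assoc], ?_⟩
      simpa [h4] using h6
    · rintro he (_ | ⟨c', cs'⟩) r' hn hk hw
      · simp at hn
      · rw [List.flatMap_cons, List.append_assoc] at hw
        by_cases he₁ : e₁ = []
        · obtain ⟨h3, h4⟩ := h1 he₁
          rw [h3] at hw
          obtain ⟨rfl, hw'⟩ := unary_append_inj hw
          refine h2' (fun h => he (by rw [h, he₁]; rfl)) cs' r' (by simpa using hn)
            (fun c hc => hk c (List.mem_cons_of_mem _ hc)) hw'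
        · exact h1' he₁ c' _ (hk c' List.mem_cons_self) hw

theorem runR_colours (k n : ℕ) (w : List Bool) (σ : Regs) : ∃ (cs : List ℕ) (r e : List Bool),
    cs.length = n ∧ r.length ≤ w.length ∧
    RunR O Q coloursProg
      { σ with
        inp := w, sub := List.replicate k false, subT := [], fut := List.replicate n true,
        cnt := [], colT := [], col := [] }
      { σ with
        inp := r
        col := cs.flatMap unary
        colT := []
        sub := List.replicate k false
        subT := []
        fut := List.replicate n true
        cnt := []
        err := e ++ σ.err } (n * (6 * w.length + 4 * k + 20) + 4 * w.length + 3) ∧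
    (e = [] → w = cs.flatMap unary ++ r ∧ ∀ c ∈ cs, c < k) ∧
    (e ≠ [] → ∀ (cs' : List ℕ) r', cs'.length = n → (∀ c ∈ cs', c < k) → w ≠ cs'.flatMap unary ++ r') := by
  obtain ⟨cs, r, e, hcs, hl, hl', hrun, h2, h2'⟩ := runR_colours_loop (O := O) (Q := Q) k n w
    { σ with cnt := [], colT := [], col := [] }
  refine ⟨cs, r, e, hcs, hl', ?_, h2, h2'⟩
  have h := Run.seq hrun (Run.seq (RunR.move 11 7 _ _ rfl) (RunR.move 4 3 _ _ rfl))
  simp only [Regs.set, Regs.store, List.append_nil, List.reverse_reverse, List.reverse_replicate]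
    at h
  refine Run.mono h ?_
  simp only [List.length_reverse, List.length_replicate]
  nlinarith

theorem runR_header (w : List Bool) : ∃ k n r e,
    k + n + r.length ≤ w.length ∧
    RunR O Q headerProg (initRegs w)
      { initRegs r with sub := List.replicate k false, fut := List.replicate n true, err := e }
      (30 * w.length + 20) ∧
    (e = [] → 1 ≤ k ∧ w = unary k ++ (unary n ++ r)) ∧
    (e ≠ [] → ∀ k' n' r', 1 ≤ k' → w ≠ unary k' ++ (unary n' ++ r')) := by
  obtain ⟨k, r₁, e₁, hl₁, hrun₁, h1, h1'⟩ := runR_unary (O := O) (Q := Q) w (initRegs w)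
  obtain ⟨e₂, hrun₂, h2⟩ := runR_need (O := O) (Q := Q)
    { initRegs r₁ with sub := List.replicate k false, err := e₁ ++ [] } 1
  obtain ⟨n, r, e₃, hl₃, hrun₃, h3, h3'⟩ := runR_unary (O := O) (Q := Q) r₁
    { initRegs r₁ with sub := List.replicate k false, err := e₂ ++ (e₁ ++ []) }
  have hmove := RunR.move (O := O) (Q := Q) 10 1
    { initRegs r₁ with res := List.replicate k false, err := e₁ ++ [] } _ rfl
  simp only [Regs.set, Regs.store, initRegs, List.append_nil, List.reverse_replicate] at hmove
  simp only [initRegs, List.append_nil] at hrun₁ hrun₂ hrun₃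
  have h := Run.seq hrun₁ (Run.seq (RunR.clear 11 _ _ rfl) (Run.seq hmove
    (Run.seq hrun₂ (Run.seq hrun₃ (Run.seq (RunR.clear 10 _ _ rfl) (RunR.move 11 7 _ _ rfl))))))
  simp only [Regs.set, Regs.store, List.append_nil, List.reverse_replicate,
    List.length_replicate] at h
  simp only [Regs.store, ne_eq, List.replicate_eq_nil_iff] at h2
  refine ⟨k, n, r, e₃ ++ (e₂ ++ e₁), by omega, Run.mono h (by omega), ?_, ?_⟩
  · intro he
    simp only [List.append_eq_nil_iff] at he
    have := h2.mp he.2.1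
    exact ⟨by omega, by rw [h1 he.2.2, ← h3 he.1]⟩
  · intro he k' n' r' hk' hw
    by_cases he₁ : e₁ = []
    · rw [h1 he₁] at hw
      obtain ⟨rfl, hw'⟩ := unary_append_inj hw
      by_cases he₃ : e₃ = []
      · exact he (by rw [he₁, he₃, h2.mpr (by omega)]; rfl)
      · exact h3' he₃ n' r' hw'
    · exact h1' he₁ k' _ hw

theorem length_selectRow_le (keep : Bool) (past g : List Bool) :
    (selectRow keep past g).length ≤ g.length := by
  induction past generalizing g with
  | nil => simp [selectRow]
  | cons m past ih =>
    cases g with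
    | nil => simp [selectRow]
    | cons b g =>
      have := ih g
      rw [selectRow]
      split_ifs <;> simp <;> omega

theorem length_selectRows_le (past fut g : List Bool) :
    (selectRows past fut g).length ≤ g.length := by
  induction fut generalizing past g with
  | nil => simp [selectRows]
  | cons keep fut ih =>
    have h1 := length_selectRow_le keep past (g.take past.length)
    have h2 := ih (past ++ [keep]) (g.drop past.length)
    rw [selectRows, List.length_append]
    simp only [List.length_take, List.length_drop] at h1 h2
    omega

/-- Filtering with every mark set raises the flag if the word is too short, and the test for a
remainder raises it if the word is too long. No other condition on a matrix is needed. -/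
theorem runR_matrix (n : ℕ) (w : List Bool) (σ : Regs) : ∃ g r e s,
    g.length = rowsLength 0 n ∧ s.length ≤ g.length ∧
    RunR O Q matrixProg
      { σ with inp := w, grT := [], gr := [], past := [], pastT := [], res := [], cnt := [],
               fut := List.replicate n true }
      { σ with inp := [], grT := g.reverse, gr := r, past := List.replicate n true, pastT := [],
               res := s, cnt := List.replicate n true, fut := [], err := e ++ σ.err }
      (8 * w.length + n * (14 * n + 12) + 5) ∧
    (e = [] → w = g ∧ r = []) ∧ (e ≠ [] → w.length ≠ rowsLength 0 n) := by
  have h1 := RunR.move (O := O) (Q := Q) 0 9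
    { σ with inp := w, grT := [], gr := [], past := [], pastT := [], res := [], cnt := [],
             fut := List.replicate n true } _ rfl
  have h2 := RunR.move (O := O) (Q := Q) 9 8
    { σ with inp := [], grT := w.reverse, gr := [], past := [], pastT := [], res := [], cnt := [],
             fut := List.replicate n true } _ rfl
  obtain ⟨g, r, e, hg, h3, h4, h5⟩ := runR_filter (O := O) (Q := Q) (List.replicate n true) []
    { σ with inp := [], gr := w, grT := [], res := [], cnt := [] }
  simp only [List.length_replicate, List.length_nil] at hg h4 h5
  simp only [Regs.set, Regs.store, List.append_nil, List.reverse_reverse] at h1 h2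
  simp only [List.append_nil, List.nil_append, List.count_replicate_self, List.length_replicate,
    List.length_nil, zero_add] at h3
  obtain ⟨e', h6, h6'⟩ : ∃ e', RunR O Q (.ite 8 Option.isSome (.push 15 true) .skip)
      { σ with inp := [], grT := g.reverse, gr := r, past := List.replicate n true, pastT := [],
               res := (selectRows [] (List.replicate n true) g).reverse,
               cnt := List.replicate n true, fut := [], err := e ++ σ.err }
      { σ with inp := [], grT := g.reverse, gr := r, past := List.replicate n true, pastT := [],
               res := (selectRows [] (List.replicate n true) g).reverse,
               cnt := List.replicate n true, fut := [], err := e' ++ (e ++ σ.err) } 2 ∧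
      (e' = [] ↔ r = []) := by
    cases r with
    | nil => exact ⟨[], Run.ite_false rfl (Run.skip _), by simp⟩
    | cons b r => exact ⟨[true], Run.ite_true rfl (RunR.push _ 15 true), by simp⟩
  refine ⟨g, r, e' ++ e, (selectRows [] (List.replicate n true) g).reverse, hg, ?_, ?_, ?_, ?_⟩
  · rw [List.length_reverse]; exact length_selectRows_le _ _ _
  · rw [List.append_assoc]
    refine Run.mono (Run.seq h1 (Run.seq h2 (Run.seq h3 h6))) ?_
    simp only [List.length_reverse]
    omega
  · intro he
    rw [List.append_eq_nil_iff] at he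
    have hr := h6'.mp he.1
    exact ⟨by rw [h4 he.2, hr, List.append_nil], hr⟩
  · intro he hw
    by_cases h0 : e = []
    · have h7 := congrArg List.length (h4 h0)
      rw [List.length_append, hw, hg] at h7
      have hr : r = [] := List.length_eq_zero_iff.mp (by omega)
      exact he (by rw [h0, h6'.mpr hr]; rfl)
    · have := h5 h0
      omega

/-- Stack 0 ends up empty in both cases: for an invalid word this already is the output 0, and for a
valid one the answer will be written there. -/
theorem runR_parse (w : List Bool) : ∃ τ : Regs,
    RunR O Q parseProg (initRegs w) τ (100 * (w.length + 1) ^ 2) ∧ τ.inp = [] ∧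
    ((∃ x : ColouredInstance, w = x.encode ∧ τ.err = [] ∧
      RunR O Q cleanProg τ (sumRegs x (List.replicate x.k false) [] []) (20 * (w.length + 1))) ∨
    (τ.err ≠ [] ∧ ∀ x : ColouredInstance, w ≠ x.encode)) := by
  obtain ⟨k, n, r₁, e₁, hl₁, hrun₁, h1, h1'⟩ := runR_header (O := O) (Q := Q) w
  obtain ⟨cs, r₂, e₂, hcs, hl₂, hrun₂, h2, h2'⟩ := runR_colours (O := O) (Q := Q) k n r₁
    { initRegs r₁ with err := e₁ }
  obtain ⟨g, r₃, e₃, s, hg, hs, hrun₃, h3, h3'⟩ := runR_matrix (O := O) (Q := Q) n r₂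
    { initRegs r₂ with
      col := cs.flatMap unary, sub := List.replicate k false, err := e₂ ++ e₁ }
  refine ⟨_, (Run.seq hrun₁ (Run.seq hrun₂ hrun₃)).mono ?_, rfl, ?_⟩
  · have a1 : k ≤ w.length := by omega
    have a2 : n ≤ w.length := by omega
    have a3 : r₁.length ≤ w.length := by omega
    have a4 : r₂.length ≤ w.length := by omega
    have b1 := Nat.mul_le_mul a2 a3
    have b2 := Nat.mul_le_mul a2 a1
    have b3 := Nat.mul_le_mul a2 a2
    nlinarith
  by_cases he : e₃ ++ (e₂ ++ e₁) = []
  · left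
    have he' := he
    simp only [List.append_eq_nil_iff] at he'
    obtain ⟨hk, hw⟩ := h1 he'.2.2
    obtain ⟨hr₁, hck⟩ := h2 he'.2.1
    obtain ⟨rfl, rfl⟩ := h3 he'.1
    obtain ⟨G, rfl⟩ := exists_graphBits_eq r₂ hg
    have hcol : cs.flatMap unary = colourBits fun v : Fin n =>
        (⟨cs[v.val], hck _ (List.getElem_mem _)⟩ : Fin k) := by
      rw [colourBits_eq]
      congr 1
      refine List.ext_getElem (by simp [hcs]) fun i h4 h5 => ?_
      simp
    refine ⟨⟨k, hk, n, G, fun v => ⟨cs[v.val], hck _ (List.getElem_mem _)⟩⟩, ?_, he, ?_⟩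
    · rw [hw, hr₁, hcol]; rfl
    · have h := Run.seq (RunR.clear (O := O) (Q := Q) 5 { initRegs [] with
          col := cs.flatMap unary, sub := List.replicate k false,
          grT := (graphBits G).reverse, past := List.replicate n true, res := s,
          cnt := List.replicate n true } _ rfl)
        (Run.seq (RunR.clear 10 _ _ rfl) (Run.seq (RunR.clear 11 _ _ rfl)
          (RunR.move 9 8 _ _ rfl)))
      rw [he, hcol]
      rw [hcol] at h
      simp only [Regs.set, Regs.store, initRegs, List.append_nil, List.reverse_reverse] at h
      refine Run.mono h ?_
      simp only [List.length_replicate, List.length_reverse]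
      omega
  · right
    refine ⟨he, ?_⟩
    intro x hw
    by_cases he₁ : e₁ = []
    · have h4 := (h1 he₁).2
      rw [hw, ColouredInstance.encode] at h4
      obtain ⟨rfl, h6⟩ := unary_append_inj h4
      obtain ⟨rfl, h7⟩ := unary_append_inj h6
      rw [colourBits_eq] at h7
      by_cases he₂ : e₂ = []
      · rw [(h2 he₂).1] at h7
        -- Two readings with equally many unary blocks leave the same rest, so the matrix of `x` is
        -- exactly what `matrixProg` received.
        have h5 : ∀ (l l' : List ℕ) (u u' : List Bool), l.length = l'.length →
            l.flatMap unary ++ u = l'.flatMap unary ++ u' → u = u' := by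
          intro l
          induction l with
          | nil => rintro (_ | _) u u' hl h <;> simp_all
          | cons c l ih =>
            rintro (_ | ⟨c', l'⟩) u u' hl h
            · simp at hl
            · simp only [List.flatMap_cons, List.append_assoc] at h
              exact ih l' u u' (by simpa using hl) (unary_append_inj h).2
        have h8 := h5 _ _ _ _ (by simp [hcs]) h7
        by_cases he₃ : e₃ = []
        · exact he (by rw [he₁, he₂, he₃]; rfl)
        · exact h3' he₃ (by rw [← h8, length_graphBits])
      · exact h2' he₂ _ _ (by simp) (by simp) h7.symm
    · exact h1' he₁ _ _ _ x.k_pos hw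

end Programs

/-- The reduction. -/
def reductionProg : Prog :=
  .seq parseProg (.ite 15 Option.isSome .skip (.seq cleanProg countColourfulProg))

theorem mainTheorem9 (Φ : PropertyFamily) :
    FptTuringReducible (multicolourInducedSubgraphWithProperty Φ)
      (inducedSubgraphWithProperty Φ) := by
  -- Parsing and cleaning cost at most 120 times the squared length, counting costs 163 times `2 ^
  -- k` times the squared size, and 400 leaves room for the additive constants. Every query has
  -- parameter `k`, hence `id`.
  refine ⟨reductionProg, fun k => 400 * 2 ^ k, id, 2, computable_mul_two_pow 400, Computable.id,
    fun w => ?_⟩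
  have hpow : ∀ k, 1 ≤ 2 ^ k := fun k => Nat.one_le_two_pow
  obtain ⟨τ, hparse, hinp, ⟨x, rfl, herr, hclean⟩ | ⟨herr, hw⟩⟩ :=
    runR_parse (O := (inducedSubgraphWithProperty Φ).count) (Q := ParamLe (leadingOnes w)) w
  · obtain ⟨hcount, hparam⟩ := multicolourInducedSubgraphWithProperty_encode Φ x
    have hk : leadingOnes x.encode = x.k := hparam
    obtain ⟨τ', hres, hmain⟩ := runR_countColourful Φ x
    rw [hk] at hparse hclean
    obtain ⟨t, qs, hexec, ht, hqs⟩ := Run.seq hparse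
      (Run.ite_false (i := 15) (c := Option.isSome) (p := .skip)
        (by change Option.isSome τ.err.head? = false; rw [herr]; rfl) (Run.seq hclean hmain))
    refine ⟨τ'.store, t, qs, ?_, ?_, ?_, ?_⟩
    · rw [init_eq_store]; exact hexec
    · rw [hcount]; exact hres
    · refine ht.trans ?_
      rw [hparam]
      have h1 := x.size_le_length_encode
      have h2 : x.size ^ 2 ≤ (x.encode.length + 1) ^ 2 := Nat.pow_le_pow_left (by omega) 2
      have h3 : x.encode.length + 1 ≤ (x.encode.length + 1) ^ 2 := Nat.le_self_pow (by omega) _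
      have h4 := Nat.mul_le_mul_left (2 ^ x.k) h2
      have h5 := Nat.mul_le_mul_right ((x.encode.length + 1) ^ 2) (hpow x.k)
      simp only
      nlinarith
    · intro q hq
      rw [hparam]
      exact hqs q hq
  · obtain ⟨t, qs, hexec, ht, hqs⟩ := Run.seq hparse
      (Run.ite_true (i := 15) (c := Option.isSome) (q := .seq cleanProg countColourfulProg)
        (by change Option.isSome τ.err.head? = true; simpa [List.isSome_head?] using herr)
        (Run.skip _))
    refine ⟨τ.store, t, qs, ?_, ?_, ?_, fun q hq => hqs q hq⟩
    · rw [init_eq_store]; exact hexec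
    -- A word outside the range of the encoding has value 0, whose binary expansion is the empty
    -- word.
    · have h0 : (multicolourInducedSubgraphWithProperty Φ).count w = 0 := by
        exact Function.extend_apply' (fun x => colStrEmb (Φ.graphs x.k) x.graph x.colour)
          (fun _ => 0) w fun ⟨x, hx⟩ => hw x hx.symm
      rw [h0, Nat.zero_bits]
      exact hinp
    · refine ht.trans ?_
      have h5 := Nat.mul_le_mul_right ((w.length + 1) ^ 2)
        (hpow ((multicolourInducedSubgraphWithProperty Φ).param w))
      have h3 : w.length + 1 ≤ (w.length + 1) ^ 2 := Nat.le_self_pow (by omega) _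
      simp only
      nlinarith
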